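/- Let $N\ge 2$, $E=\{0,\ldots,N-1\}$, $d,p,q\ge 0$, let $B_1,\ldots,B_q$, $A_1,\ldots,A_p$ be real $(N-1)\times(N-1)$ matrices and $\Gamma$ a real $(N-1)\times d$ matrix. For $y\in E$ let $\overline{y}\in\mathbb{R}^{N-1}$ be the $k$-th column of the identity matrix $I_{N-1}$ if $y=k\ge 1$, and $\overline{y}=0$ if $y=0$. Let $X=(X_t)_{t\in\mathbb{Z}}$ be a stationary and ergodic process with values in $\mathbb{R}^d$, defined on a probability space $(\Omega,\mathcal{A},\mathbb{P})$, such that $\mathbb{E}\log_+|X_1|<\infty$. A solution of the multinomial logistic autoregression driven by $X$ is a pair of processes $(Y_t)_{t\in\mathbb{Z}}$, $(\lambda_t)_{t\in\mathbb{Z}}$ with values in $E$ and $\mathbb{R}^{N-1}$ such that, almost surely for every $t\in\mathbb{Z}$, $$\mathbb{P}\left(Y_t=i\mid Y_{t-1},Y_{t-2},\ldots,X_t,X_{t-1},\ldots\right)=\frac{\exp(\lambda_{i,t})}{1+\sum_{j=1}^{N-1}\exp(\lambda_{j,t})},\qquad i=1,\ldots,N-1,$$ $$\lambda_t=\sum_{j=1}^q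 B_j\lambda_{t-j}+\sum_{\ell=1}^p A_\ell\overline{Y}_{t-\ell}+\Gamma X_t,$$ and the covariates are strictly exogenous: $$\mathbb{P}\left(Y_t=y\mid Y_{t-1},Y_{t-2},\ldots,X_t,X_{t-1},\ldots\right)=\mathbb{P}\left(Y_t=y\mid Y_{t-1},Y_{t-2},\ldots,(X_s)_{s\in\mathbb{Z}}\right),\qquad y\in E.$$ The solution is called stationary if the process $((Y_t,X_t))_{t\in\mathbb{Z}}$ is strictly stationary. Assume that all the complex roots $z$ of the polynomial $\mathcal{P}(z)=\det\left(I_{N-1}-\sum_{j=1}^q B_jz^j\right)$ satisfy $|z|>1$. Then there exists a stationary solution, defined on the enlargement $\Omega\times E^{\mathbb{Z}}$ of $\Omega$ endowed with a probability measure with first marginal $\mathbb{P}$, where $X$ is extended by $X_t(\omega,y)=X_t(\omega)$ and $Y_t(\omega,y)=y_t$. For this solution the process $((Y_t,X_t,\lambda_t))_{t\in\mathbb{Z}}$ is stationary, and the process $((Y_t,X_t))_{t\in\mathbb{Z}}$ is stationary and ergodic. The stationary solution is unique in the following sense: for every stationary solution, on any probability space, driven by a covariate process that has the same law as $X$, the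 process $((Y_t,X_t,\lambda_t))_{t\in\mathbb{Z}}$ has the same law as the one just constructed. -/

import Mathlib

open MeasureTheory ProbabilityTheory

noncomputable section

namespace MultinomialLogit

/-- The trajectory `(Z_t)_{t ∈ ℤ}` of a process indexed by `ℤ`, as a random sequence. -/
def path {Ω S : Type*} (Z : ℤ → Ω → S) : Ω → ℤ → S := fun ω t => Z t ω

/-- The shift `(z_t)_t ↦ (z_{t+1})_t` on two-sided sequences. -/
def shift {S : Type*} : (ℤ → S) → (ℤ → S) := fun z t => z (t + 1)

/-- Strict stationarity: the law of the trajectory is invariant under the shift. -/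
def IsStationary {Ω S : Type*} [MeasurableSpace Ω] [MeasurableSpace S]
    (P : Measure Ω) (Z : ℤ → Ω → S) : Prop :=
  MeasurePreserving shift (P.map (path Z)) (P.map (path Z))

/-- Stationarity and ergodicity: the law of the trajectory is invariant under the shift, and every
shift-invariant event has probability zero or one. -/
def IsStationaryErgodic {Ω S : Type*} [MeasurableSpace Ω] [MeasurableSpace S]
    (P : Measure Ω) (Z : ℤ → Ω → S) : Prop :=
  Ergodic shift (P.map (path Z))

/-- The σ-algebra generated by the variables `Z s` with `s ∈ I`. -/
abbrev sigmaGen {Ω S : Type*} [MeasurableSpace S] (Z : ℤ → Ω → S) (I : Set ℤ) : MeasurableSpace Ω :=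
  ⨆ s ∈ I, MeasurableSpace.comap (Z s) inferInstance

/-- The coding of the category `y ∈ {0, …, n}`: the `k`-th column of the identity matrix of size
`n` if `y = k ∈ {1, …, n}`, and the zero vector if `y` is the reference category `0`. (The index
`k : Fin n` stands for the category `k + 1`.) -/
def dummy {n : ℕ} (y : Fin (n + 1)) : Fin n → ℝ := fun k => if y = k.succ then 1 else 0

/-- The probability `exp (l_i) / (1 + ∑_j exp (l_j))` of the non-reference category `i`. -/
def logit {n : ℕ} (l : Fin n → ℝ) (i : Fin n) : ℝ :=
  Real.exp (l i) / (1 + ∑ j, Real.exp (l j))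

/-- `z ↦ det (I - ∑_{j=1}^q B_j z^j)` on the complex plane; `B j` is the matrix of lag `j + 1`. -/
def charFun {n q : ℕ} (B : Fin q → Matrix (Fin n) (Fin n) ℝ) (z : ℂ) : ℂ :=
  (1 - ∑ j : Fin q, z ^ ((j : ℕ) + 1) • (B j).map (algebraMap ℝ ℂ)).det

/-- `(Y, lam)` solves the multinomial logistic autoregression driven by the covariate process `X`
on the probability space `(Ω, P)`. The category set is `{0, …, n}`; `B j`, `A l` are the matrices
of lags `j + 1`, `l + 1`. -/
structure IsSolution {n d p q : ℕ} (B : Fin q → Matrix (Fin n) (Fin n) ℝ)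
    (A : Fin p → Matrix (Fin n) (Fin n) ℝ) (Γ : Matrix (Fin n) (Fin d) ℝ)
    {Ω : Type*} [MeasurableSpace Ω] (P : Measure Ω)
    (X : ℤ → Ω → Fin d → ℝ) (Y : ℤ → Ω → Fin (n + 1)) (lam : ℤ → Ω → Fin n → ℝ) : Prop where
  measurable_X : ∀ t, Measurable (X t)
  measurable_Y : ∀ t, Measurable (Y t)
  measurable_lam : ∀ t, Measurable (lam t)
  /-- The recursion for the latent process. -/
  recursion : ∀ t, ∀ᵐ ω ∂P, lam t ω =
    ∑ j : Fin q, (B j).mulVec (lam (t - ((j : ℤ) + 1)) ω)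
      + ∑ l : Fin p, (A l).mulVec (dummy (Y (t - ((l : ℤ) + 1)) ω))
      + Γ.mulVec (X t ω)
  /-- The conditional probabilities given `Y_{t-1}, Y_{t-2}, …` and `X_t, X_{t-1}, …`. -/
  condProb : ∀ (t : ℤ) (i : Fin n),
    P⟦Y t ⁻¹' {i.succ} | sigmaGen Y (Set.Iio t) ⊔ sigmaGen X (Set.Iic t)⟧
      =ᵐ[P] fun ω => logit (lam t ω) i
  /-- Strict exogeneity of the covariates: given `Y_{t-1}, Y_{t-2}, …` and `X_t, X_{t-1}, …`, the
  future of `X` brings no information on `Y_t`. -/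
  exogenous : ∀ (t : ℤ) (y : Fin (n + 1)),
    P⟦Y t ⁻¹' {y} | sigmaGen Y (Set.Iio t) ⊔ sigmaGen X (Set.Iic t)⟧
      =ᵐ[P] P⟦Y t ⁻¹' {y} | sigmaGen Y (Set.Iio t) ⊔ sigmaGen X Set.univ⟧

end MultinomialLogit

end

open MeasureTheory ProbabilityTheory

set_option linter.unusedSectionVars false

noncomputable section

namespace MultinomialLogit

/-! The latent process is first eliminated. The root condition puts the spectrum of the block
companion operator inside the open unit disc, so its powers decay geometrically
(`exists_norm_companion_pow_le`). Hence the latent variable can be written as a series in the past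
categories and covariates (`latent`). The categorical part converges because its input is bounded.
The covariate part converges almost surely by Borel–Cantelli and the logarithmic moment
(`ae_stateSummable`).

What remains is a chain with infinite memory in a random environment: given the past categories and
the whole covariate path, `Y_t` has law `logitKernel`. Changing categories older than `k` steps
moves the latent variable by `O(σ ^ k)`, uniformly in the covariates, and so multiplies the kernel
by at most `exp (r k)` with `r` summable (`exists_isSpec_logitKernel`). Laws on the path space with
these conditional probabilities are called Gibbs.

Uniqueness (`IsGibbs.eq_of_map_covariates_eq`): summable distortion makes any two finite Gibbs
measures with the same covariate law comparable, with a universal constant. The difference between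
one and a dominated multiple of the other is again Gibbs, so the comparison can be iterated until
nothing is left. Existence (`exists_isGibbs`): categories are drawn successively on growing
intervals, and a weak limit is taken. Tightness is free because the category space is compact and
the covariate law is fixed.

Uniqueness then yields the other properties. The shift of a Gibbs measure is Gibbs, hence
stationarity. The restriction to an invariant event is Gibbs, because such an event can be
approximated from the past; ergodicity of the covariates makes its covariate law a multiple of the
original one, so the restriction itself is a multiple of the whole measure (`IsGibbs.ergodic`).

For an arbitrary stationary solution, inverting the logistic map shows that the latent process is a
fixed function of the shifted trajectory. Its difference with `latent` is stationary and solves a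
contracting homogeneous recursion, so it vanishes (`IsSolution.lam_eq_latent`). Strict exogeneity
then makes the trajectory law Gibbs. -/

open Set Filter Topology
open scoped ENNReal NNReal

/-! ### Windows, cylinders and local events on the path space. -/

section PathSpace

variable {E S : Type*} [MeasurableSpace E] [MeasurableSpace S]

/-- The covariate trajectory of a trajectory of pairs. -/
def covariates (z : ℤ → E × S) : ℤ → S := fun s => (z s).2

/-- The trajectory of pairs with given components. -/
def pairing (v : ℤ → E) (x : ℤ → S) : ℤ → E × S := fun s => (v s, x s)

/-- The trajectories whose categories agree with those of `v` on `I`. -/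
def cyl (I : Set ℤ) (v : ℤ → E) : Set (ℤ → E × S) := {z | ∀ s ∈ I, (z s).1 = v s}

@[fun_prop]
lemma measurable_covariates : Measurable (covariates (E := E) (S := S)) := by
  unfold covariates; fun_prop

@[fun_prop]
lemma measurable_pairing (v : ℤ → E) : Measurable (pairing (S := S) v) := by
  unfold pairing; fun_prop

variable [Inhabited E] [Inhabited S]

open Classical in
/-- The trajectory where the categories outside `I` and the covariates outside `J` are replaced by
default values. -/
def mask (I J : Set ℤ) (z : ℤ → E × S) : ℤ → E × S :=
  fun s => (if s ∈ I then (z s).1 else default, if s ∈ J then (z s).2 else default)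

/-- The σ-algebra generated by the categories at times in `I` and the covariates at times
in `J`. -/
abbrev window (I J : Set ℤ) : MeasurableSpace (ℤ → E × S) :=
  MeasurableSpace.comap (mask I J) MeasurableSpace.pi

lemma measurable_mask (I J : Set ℤ) : Measurable (mask (E := E) (S := S) I J) := by
  refine measurable_pi_lambda _ fun s => Measurable.prodMk ?_ ?_
  · by_cases h : s ∈ I
    · simp only [h, if_true]; fun_prop
    · simp only [h, if_false]; fun_prop
  · by_cases h : s ∈ J
    · simp only [h, if_true]; fun_prop
    · simp only [h, if_false]; fun_prop

lemma window_le (I J : Set ℤ) : window (E := E) (S := S) I J ≤ MeasurableSpace.pi :=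
  (measurable_mask I J).comap_le

lemma mask_mask {I I' J J' : Set ℤ} (hI : I ⊆ I') (hJ : J ⊆ J') (z : ℤ → E × S) :
    mask I J (mask I' J' z) = mask I J z := by
  funext s
  by_cases h : s ∈ I <;> by_cases h' : s ∈ J <;>
    simp [mask, h, h', @hI s, @hJ s]

/-- Such a function factors through `mask`. All measurability statements for windows are reduced to
this invariance, without handling generators. -/
lemma measurable_window_of_mask {β : Type*} [MeasurableSpace β] {I J : Set ℤ}
    {f : (ℤ → E × S) → β} (hf : Measurable f) (h : ∀ z, f (mask I J z) = f z) :
    Measurable[window I J] f := by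
  have : f = f ∘ mask I J := by funext z; exact (h z).symm
  rw [this]
  exact hf.comp (comap_measurable _)

lemma window_mono {I I' J J' : Set ℤ} (hI : I ⊆ I') (hJ : J ⊆ J') :
    window (E := E) (S := S) I J ≤ window I' J' := by
  have h := measurable_window_of_mask (I := I') (J := J') (measurable_mask (E := E) (S := S) I J)
    (fun z => mask_mask hI hJ z)
  exact h.comap_le

lemma measurable_category_window {I : Set ℤ} (J : Set ℤ) {s : ℤ} (hs : s ∈ I) :
    Measurable[window I J] fun z : ℤ → E × S => (z s).1 :=
  measurable_window_of_mask (by fun_prop) fun z => by simp [mask, hs]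

lemma measurable_covariate_window (I : Set ℤ) {J : Set ℤ} {s : ℤ} (hs : s ∈ J) :
    Measurable[window I J] fun z : ℤ → E × S => (z s).2 :=
  measurable_window_of_mask (by fun_prop) fun z => by simp [mask, hs]

lemma measurable_covariates_window (I : Set ℤ) :
    Measurable[window I univ] (covariates (E := E) (S := S)) :=
  measurable_window_of_mask (by fun_prop) fun z => by funext s; simp [mask, covariates]

/-- Links the windows, whose events are preimages under a single map, with the σ-algebras used in
`IsSolution`. -/
lemma window_eq_sigmaGen (I J : Set ℤ) :
    window (E := E) (S := S) I J =
      sigmaGen (fun s z => (z s).1) I ⊔ sigmaGen (fun s z => (z s).2) J := by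
  apply le_antisymm
  · refine measurable_iff_comap_le.1 (@measurable_pi_lambda _ _ _ (_) _ _ fun s =>
      @Measurable.prodMk _ _ _ _ _ (_) _ _ ?_ ?_)
    · by_cases h : s ∈ I
      · simp only [h, if_true]
        refine measurable_iff_comap_le.2 (le_trans ?_ le_sup_left)
        exact le_iSup₂ (f := fun s (_ : s ∈ I) =>
          MeasurableSpace.comap (fun z : ℤ → E × S => (z s).1) inferInstance) s h
      · simp only [h, if_false]
        exact measurable_const
    · by_cases h : s ∈ J
      · simp only [h, if_true]
        refine measurable_iff_comap_le.2 (le_trans ?_ le_sup_right)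
        exact le_iSup₂ (f := fun s (_ : s ∈ J) =>
          MeasurableSpace.comap (fun z : ℤ → E × S => (z s).2) inferInstance) s h
      · simp only [h, if_false]
        exact measurable_const
  · exact sup_le (iSup₂_le fun s hs => (measurable_category_window J hs).comap_le)
      (iSup₂_le fun s hs => (measurable_covariate_window I hs).comap_le)

lemma measurableSet_cyl [MeasurableSingletonClass E] {I I' : Set ℤ} (J : Set ℤ) (hI : I ⊆ I')
    (v : ℤ → E) : MeasurableSet[window I' J] (cyl (S := S) I v) := by
  have : cyl (S := S) I v = ⋂ s ∈ I, (fun z : ℤ → E × S => (z s).1) ⁻¹' {v s} := by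
    ext z; simp [cyl]
  rw [this]
  exact MeasurableSet.biInter (to_countable I) fun s hs =>
    measurable_category_window J (hI hs) (measurableSet_singleton _)

/-- An inequality between measures on cylinder events extends to the σ-algebra of a finite
window. -/
lemma measure_le_of_cyl [Finite E] [MeasurableSingletonClass E] {ν ν' : Measure (ℤ → E × S)}
    {K : ℝ≥0∞} {I : Set ℤ} (hI : I.Finite)
    (h : ∀ (v : ℤ → E) (B : Set (ℤ → S)), MeasurableSet B →
      ν (cyl I v ∩ covariates ⁻¹' B) ≤ K * ν' (cyl I v ∩ covariates ⁻¹' B))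
    {A : Set (ℤ → E × S)} (hA : MeasurableSet[window I univ] A) : ν A ≤ K * ν' A := by
  classical
  have := hI.to_subtype
  obtain ⟨A', hA', rfl⟩ := hA
  -- The filler `default` is the one used by `mask`, so on the cylinder of a word `w` the mask
  -- depends on the covariates only. The event thus splits into finitely many disjoint pieces, each
  -- a cylinder cut by a covariate event `B w`.
  let ext : (I → E) → ℤ → E := fun w s => if hs : s ∈ I then w ⟨s, hs⟩ else default
  let B : (I → E) → Set (ℤ → S) := fun w => pairing (ext w) ⁻¹' A'
  have hB : ∀ w, MeasurableSet (B w) := fun w => measurable_pairing _ hA'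
  let C : (I → E) → Set (ℤ → E × S) := fun w => cyl I (ext w) ∩ covariates ⁻¹' (B w)
  have hC : ∀ w, MeasurableSet (C w) := fun w =>
    (window_le I univ _ (measurableSet_cyl _ subset_rfl _)).inter (measurable_covariates (hB w))
  have hmask : ∀ w, ∀ z ∈ cyl (S := S) I (ext w), mask I univ z = pairing (ext w) (covariates z) := by
    intro w z hz
    funext s
    by_cases hs : s ∈ I
    · simp [mask, pairing, covariates, hs, hz s hs]
    · simp [mask, pairing, covariates, hs, ext]
  have hU : mask I univ ⁻¹' A' = ⋃ w, C w := by
    ext z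
    simp only [mem_preimage, mem_iUnion, C, mem_inter_iff, B]
    constructor
    · intro hz
      have hz' : z ∈ cyl I (ext fun s => (z s).1) := fun s hs => by simp [ext, hs]
      exact ⟨fun s => (z s).1, hz', hmask (fun s => (z s).1) z hz' ▸ hz⟩
    · rintro ⟨w, hz, hz'⟩
      rwa [hmask _ _ hz]
  have hd : Pairwise (Function.onFun Disjoint C) := by
    intro w w' hne
    refine disjoint_left.2 fun z hz hz' => hne ?_
    funext ⟨s, hs⟩
    have h1 := hz.1 s hs
    have h2 := hz'.1 s hs
    simp only [ext, hs, dif_pos] at h1 h2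
    rw [← h1, ← h2]
  rw [hU, measure_iUnion hd hC, measure_iUnion hd hC, ← ENNReal.tsum_mul_left]
  exact ENNReal.tsum_le_tsum fun w => h _ _ (hB w)

/-- The events depending on finitely many categories and on the covariates. -/
def localEvents : Set (Set (ℤ → E × S)) :=
  {A | ∃ N : ℕ, MeasurableSet[window (Ico (-(N : ℤ)) N) univ] A}

lemma isSetRing_localEvents : IsSetRing (localEvents (E := E) (S := S)) := by
  have key : ∀ A ∈ localEvents (E := E) (S := S), ∀ B ∈ localEvents (E := E) (S := S), ∃ N : ℕ,
      MeasurableSet[window (Ico (-(N : ℤ)) N) univ] A ∧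
      MeasurableSet[window (Ico (-(N : ℤ)) N) univ] B := by
    rintro A ⟨N, hA⟩ B ⟨M, hB⟩
    refine ⟨max N M, window_mono ?_ subset_rfl _ hA, window_mono ?_ subset_rfl _ hB⟩ <;>
    · refine Ico_subset_Ico ?_ ?_ <;> push_cast <;> simp
  refine ⟨⟨0, @MeasurableSet.empty _ (_)⟩, fun A B hA hB => ?_, fun A B hA hB => ?_⟩
  · obtain ⟨N, h1, h2⟩ := key A hA B hB
    exact ⟨N, MeasurableSet.union h1 h2⟩
  · obtain ⟨N, h1, h2⟩ := key A hA B hB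
    exact ⟨N, MeasurableSet.diff h1 h2⟩

lemma generateFrom_localEvents :
    (MeasurableSpace.pi : MeasurableSpace (ℤ → E × S)) =
      MeasurableSpace.generateFrom localEvents := by
  apply le_antisymm
  · refine iSup_le fun s => ?_
    rw [← measurable_iff_comap_le]
    have hs : s ∈ Ico (-((s.natAbs + 1 : ℕ) : ℤ)) ((s.natAbs + 1 : ℕ) : ℤ) := by
      constructor <;> omega
    have h1 := (measurable_category_window (E := E) (S := S) univ hs).prodMk
      (measurable_covariate_window (E := E) (S := S) (Ico (-((s.natAbs + 1 : ℕ) : ℤ))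
        ((s.natAbs + 1 : ℕ) : ℤ)) (mem_univ s))
    intro A hA
    exact MeasurableSpace.measurableSet_generateFrom ⟨_, h1 hA⟩
  · refine MeasurableSpace.generateFrom_le ?_
    rintro A ⟨N, hA⟩
    exact window_le _ _ _ hA

lemma exists_localEvents_symmDiff_lt (ν : Measure (ℤ → E × S)) [IsFiniteMeasure ν]
    {A : Set (ℤ → E × S)} (hA : MeasurableSet A) {ε : ℝ≥0∞} (hε : 0 < ε) :
    ∃ B ∈ localEvents, ν (symmDiff B A) < ε :=
  exists_measure_symmDiff_lt_of_generateFrom_isSetRing isSetRing_localEvents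
    ⟨{univ}, countable_singleton _, by simp [localEvents], by simp⟩ generateFrom_localEvents hA hε

/-- An inequality between finite measures on local events extends to all events. -/
lemma measure_le_of_localEvents {ν ν' : Measure (ℤ → E × S)} [IsFiniteMeasure ν]
    [IsFiniteMeasure ν'] {K : ℝ≥0∞} (hK : K ≠ ∞) (h : ∀ A ∈ localEvents, ν A ≤ K * ν' A) :
    ν ≤ K • ν' := by
  refine Measure.le_iff.2 fun A hA => ?_
  have hlim : Tendsto (fun ε : ℝ≥0∞ => K * (ν' A + ε) + ε) (𝓝[>] 0) (𝓝 (K * (ν' A + 0) + 0)) := by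
    refine Tendsto.mono_left ?_ nhdsWithin_le_nhds
    exact (ENNReal.Tendsto.const_mul (tendsto_const_nhds.add tendsto_id) (Or.inr hK)).add tendsto_id
  have : (𝓝[>] (0 : ℝ≥0∞)).NeBot := by infer_instance
  rw [Measure.smul_apply, smul_eq_mul]
  simp only [add_zero] at hlim
  refine ge_of_tendsto hlim ?_
  filter_upwards [self_mem_nhdsWithin] with ε hε
  -- Approximating for the sum gives one local event that is good for both measures.
  obtain ⟨B, hB, hBε⟩ := exists_localEvents_symmDiff_lt (ν + ν') hA hε
  rw [Measure.add_apply] at hBε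
  have h1 : ν A ≤ ν B + ε := by
    refine (measure_mono (t := B ∪ symmDiff B A) ?_).trans ((measure_union_le _ _).trans ?_)
    · intro z hz; by_cases hzB : z ∈ B <;> simp [Set.mem_symmDiff, hz, hzB]
    · gcongr; exact (le_self_add).trans hBε.le
  have h2 : ν' B ≤ ν' A + ε := by
    refine (measure_mono (t := A ∪ symmDiff B A) ?_).trans ((measure_union_le _ _).trans ?_)
    · intro z hz; by_cases hzA : z ∈ A <;> simp [Set.mem_symmDiff, hz, hzA]
    · gcongr; exact (le_add_self).trans hBε.le
  calc ν A ≤ ν B + ε := h1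
    _ ≤ K * ν' B + ε := by gcongr; exact h B hB
    _ ≤ K * (ν' A + ε) + ε := by gcongr

end PathSpace

/-! ### Gibbs measures with summable distortion: comparison and uniqueness. -/

section Gibbs

variable {E S : Type*} [MeasurableSpace E] [MeasurableSpace S] [Inhabited E] [Inhabited S]

/-- The conditional probability of category `y` at time `t`, given the previous categories and all
the covariates, is `g t y`. -/
def IsGibbs (g : ℤ → E → (ℤ → E × S) → ℝ≥0∞) (Q : Measure (ℤ → E × S)) : Prop :=
  ∀ (t : ℤ) (y : E) (A : Set (ℤ → E × S)), MeasurableSet[window (Iio t) univ] A →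
    Q (A ∩ {z | (z t).1 = y}) = ∫⁻ z in A, g t y z ∂Q

/-- A family of conditional probabilities of the category given the previous categories and all
the covariates, with bounded distortion with respect to the remote categories. -/
structure IsSpec [Fintype E] (g : ℤ → E → (ℤ → E × S) → ℝ≥0∞) (r : ℕ → ℝ) : Prop where
  measurable : ∀ t y, Measurable (g t y)
  mask : ∀ t y z, g t y (mask (Iio t) univ z) = g t y z
  sum_eq_one : ∀ t z, ∑ y, g t y z = 1
  nonneg : ∀ k, 0 ≤ r k
  summable : Summable r
  distortion : ∀ (t : ℤ) (y : E) (k : ℕ) (z z' : ℤ → E × S), covariates z = covariates z' →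
    (∀ s ∈ Ico (t - k) t, (z s).1 = (z' s).1) →
    g t y z ≤ ENNReal.ofReal (Real.exp (r k)) * g t y z'

variable [Fintype E] {g : ℤ → E → (ℤ → E × S) → ℝ≥0∞} {r : ℕ → ℝ}

lemma IsSpec.measurable_window (hg : IsSpec g r) (t : ℤ) (y : E) :
    Measurable[window (Iio t) univ] (g t y) :=
  measurable_window_of_mask (hg.measurable t y) (hg.mask t y)

lemma IsSpec.le_one (hg : IsSpec g r) (t : ℤ) (y : E) (z : ℤ → E × S) : g t y z ≤ 1 :=
  (hg.sum_eq_one t z) ▸ Finset.single_le_sum (f := fun y => g t y z) (fun _ _ => zero_le)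
    (Finset.mem_univ y)

lemma IsGibbs.smul {Q : Measure (ℤ → E × S)} (hQ : IsGibbs g Q) (c : ℝ≥0∞) :
    IsGibbs g (c • Q) := by
  intro t y A hA
  rw [Measure.smul_apply, hQ t y A hA, Measure.restrict_smul, lintegral_smul_measure]

lemma IsSpec.setLIntegral_ne_top (hg : IsSpec g r) (Q : Measure (ℤ → E × S)) [IsFiniteMeasure Q]
    (t : ℤ) (y : E) (A : Set (ℤ → E × S)) : ∫⁻ z in A, g t y z ∂Q ≠ ∞ := by
  refine ((lintegral_mono fun z => hg.le_one t y z).trans_lt ?_).ne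
  simp

/-- The Gibbs identity is additive in the measure and its terms for `Q'` are finite, so they cancel.
This is what allows subtraction in the uniqueness argument. -/
lemma IsGibbs.of_add {Q Q' : Measure (ℤ → E × S)} [IsFiniteMeasure Q'] (hg : IsSpec g r)
    (hQ' : IsGibbs g Q') (h : IsGibbs g (Q + Q')) : IsGibbs g Q := by
  intro t y A hA
  have := h t y A hA
  rw [Measure.add_apply, Measure.restrict_add, lintegral_add_measure, hQ' t y A hA] at this
  exact (ENNReal.add_left_inj (hg.setLIntegral_ne_top Q' t y A)).1 this

variable [MeasurableSingletonClass E]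

lemma measurableSet_category (t : ℤ) (y : E) : MeasurableSet {z : ℤ → E × S | (z t).1 = y} := by
  have : Measurable fun z : ℤ → E × S => (z t).1 := by fun_prop
  exact this (measurableSet_singleton y)

lemma IsGibbs.setLIntegral_category {Q : Measure (ℤ → E × S)} (hg : IsSpec g r) (hQ : IsGibbs g Q)
    (t : ℤ) (y : E) {F : (ℤ → E × S) → ℝ≥0∞} (hF : Measurable[window (Iio t) univ] F) :
    ∫⁻ z in {z | (z t).1 = y}, F z ∂Q = ∫⁻ z, F z * g t y z ∂Q := by
  have hle := window_le (E := E) (S := S) (Iio t) univ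
  have h : (Q.restrict {z | (z t).1 = y}).trim hle = (Q.withDensity (g t y)).trim hle := by
    refine @Measure.ext _ (_) _ _ fun A hA => ?_
    rw [trim_measurableSet_eq hle hA, trim_measurableSet_eq hle hA,
      Measure.restrict_apply (hle A hA), withDensity_apply _ (hle A hA), hQ t y A hA]
  rw [← lintegral_trim hle hF, h, lintegral_trim hle hF,
    lintegral_withDensity_eq_lintegral_mul _ (hg.measurable t y) (hF.mono hle le_rfl)]
  simp only [Pi.mul_apply, mul_comm]

lemma cyl_Ico_succ (s : ℤ) (m : ℕ) (v : ℤ → E) :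
    cyl (S := S) (Ico s (s + (m + 1 : ℕ))) v =
      cyl (Ico s (s + m)) v ∩ {z | (z (s + m)).1 = v (s + m)} := by
  ext z
  simp only [cyl, mem_ofPred_eq, mem_inter_iff]
  constructor
  · intro h
    refine ⟨fun u hu => h u ⟨hu.1, ?_⟩, h _ ⟨by omega, ?_⟩⟩
    · have := hu.2; push_cast; omega
    · push_cast; omega
  · rintro ⟨h1, h2⟩ u hu
    rcases lt_or_ge u (s + m) with h | h
    · exact h1 u ⟨hu.1, h⟩
    · have h3 := hu.2
      push_cast at h3
      have : u = s + m := by omega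
      rw [this, h2]

/-- Integrates out the last letter of a word. The factor `F` passes through because all covariates,
future ones included, belong to the conditioning. -/
lemma IsGibbs.setLIntegral_cyl_succ {Q : Measure (ℤ → E × S)} (hg : IsSpec g r) (hQ : IsGibbs g Q)
    (v : ℤ → E) (s : ℤ) (m : ℕ) {F : (ℤ → S) → ℝ≥0∞} (hF : Measurable F) :
    ∫⁻ z in cyl (Ico s (s + (m + 1 : ℕ))) v, F (covariates z) ∂Q =
      ∫⁻ z in cyl (Ico s (s + m)) v, F (covariates z) * g (s + m) (v (s + m)) z ∂Q := by
  have hsub : Ico s (s + (m : ℤ)) ⊆ Iio (s + (m : ℤ)) := fun u hu => hu.2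
  have hc : MeasurableSet[window (Iio (s + (m : ℤ))) univ] (cyl (S := S) (Ico s (s + m)) v) :=
    measurableSet_cyl _ hsub v
  have hc' := window_le _ _ _ hc
  have h := hQ.setLIntegral_category hg (s + m) (v (s + m))
    (F := (cyl (Ico s (s + m)) v).indicator fun z => F (covariates z))
    (Measurable.indicator (hF.comp (measurable_covariates_window _)) hc)
  rw [cyl_Ico_succ, ← Measure.restrict_restrict hc', ← lintegral_indicator hc', h,
    ← lintegral_indicator hc']
  refine lintegral_congr fun z => ?_
  by_cases hz : z ∈ cyl (S := S) (Ico s (s + m)) v <;> simp [hz]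

/-- The probability of a word given the covariates, with the word itself as remote past. -/
def wordWeight (g : ℤ → E → (ℤ → E × S) → ℝ≥0∞) (v : ℤ → E) (s : ℤ) (m : ℕ) (x : ℤ → S) : ℝ≥0∞ :=
  ∏ i ∈ Finset.range m, g (s + i) (v (s + i)) (pairing v x)

/-- Letters are peeled from the right. At the letter of time `s + m`, the trajectory agrees with `v`
on the `m` preceding times, so replacing its remoter past by that of `v` costs `exp (r m)`. The
integrand `F` is arbitrary so that the induction can absorb the peeled factor. The resulting bound
sees `Q` only through its covariate law. -/
lemma IsGibbs.setLIntegral_cyl_le {Q : Measure (ℤ → E × S)} (hg : IsSpec g r) (hQ : IsGibbs g Q)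
    (v : ℤ → E) (s : ℤ) (m : ℕ) : ∀ {F : (ℤ → S) → ℝ≥0∞}, Measurable F →
    ∫⁻ z in cyl (Ico s (s + m)) v, F (covariates z) ∂Q ≤
      ENNReal.ofReal (Real.exp (∑ i ∈ Finset.range m, r i)) *
        ∫⁻ x, F x * wordWeight g v s m x ∂(Q.map covariates) := by
  induction m with
  | zero =>
    intro F hF
    simp only [Finset.range_zero, Finset.sum_empty, Real.exp_zero, ENNReal.ofReal_one, one_mul,
      wordWeight, Finset.prod_empty, mul_one]
    rw [lintegral_map hF measurable_covariates]
    exact setLIntegral_le_lintegral _ _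
  | succ m ih =>
    intro F hF
    have hG : Measurable fun x => g (s + m) (v (s + m)) (pairing v x) :=
      (hg.measurable _ _).comp (measurable_pairing v)
    have hcyl : MeasurableSet (cyl (S := S) (Ico s (s + m)) v) :=
      window_le _ univ _ (measurableSet_cyl _ subset_rfl v)
    rw [hQ.setLIntegral_cyl_succ hg v s m hF]
    calc ∫⁻ z in cyl (Ico s (s + m)) v, F (covariates z) * g (s + m) (v (s + m)) z ∂Q
        ≤ ∫⁻ z in cyl (Ico s (s + m)) v, ENNReal.ofReal (Real.exp (r m)) *
            (F (covariates z) * g (s + m) (v (s + m)) (pairing v (covariates z))) ∂Q := by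
          refine setLIntegral_mono' hcyl fun z hz => ?_
          rw [mul_left_comm]
          gcongr
          refine hg.distortion (s + m) _ m z (pairing v (covariates z)) rfl fun u hu => ?_
          rw [add_sub_cancel_right] at hu
          exact hz u hu
      _ = ENNReal.ofReal (Real.exp (r m)) * ∫⁻ z in cyl (Ico s (s + m)) v,
            F (covariates z) * g (s + m) (v (s + m)) (pairing v (covariates z)) ∂Q := by
          rw [lintegral_const_mul' _ _ ENNReal.ofReal_ne_top]
      _ ≤ ENNReal.ofReal (Real.exp (r m)) * (ENNReal.ofReal (Real.exp (∑ i ∈ Finset.range m, r i)) *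
            ∫⁻ x, F x * g (s + m) (v (s + m)) (pairing v x) * wordWeight g v s m x
              ∂(Q.map covariates)) := by
          gcongr
          exact ih (hF.mul hG)
      _ = _ := by
          rw [← mul_assoc, ← ENNReal.ofReal_mul (Real.exp_nonneg _), ← Real.exp_add,
            Finset.sum_range_succ, add_comm]
          congr 1
          refine lintegral_congr fun x => ?_
          rw [wordWeight, wordWeight, Finset.prod_range_succ]
          ring

lemma IsGibbs.le_setLIntegral_cyl {Q : Measure (ℤ → E × S)} (hg : IsSpec g r) (hQ : IsGibbs g Q)
    (v : ℤ → E) (s : ℤ) (m : ℕ) : ∀ {F : (ℤ → S) → ℝ≥0∞}, Measurable F →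
    ∫⁻ x, F x * wordWeight g v s m x ∂(Q.map covariates) ≤
      ENNReal.ofReal (Real.exp (∑ i ∈ Finset.range m, r i)) *
        ∫⁻ z in cyl (Ico s (s + m)) v, F (covariates z) ∂Q := by
  induction m with
  | zero =>
    intro F hF
    have : cyl (S := S) (Ico s (s + (0 : ℕ))) v = univ := by
      ext z; simp [cyl]
    simp only [Finset.range_zero, Finset.sum_empty, Real.exp_zero, ENNReal.ofReal_one, one_mul,
      wordWeight, Finset.prod_empty, mul_one, this, Measure.restrict_univ]
    rw [lintegral_map hF measurable_covariates]
  | succ m ih =>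
    intro F hF
    have hG : Measurable fun x => g (s + m) (v (s + m)) (pairing v x) :=
      (hg.measurable _ _).comp (measurable_pairing v)
    have hcyl : MeasurableSet (cyl (S := S) (Ico s (s + m)) v) :=
      window_le _ univ _ (measurableSet_cyl _ subset_rfl v)
    rw [hQ.setLIntegral_cyl_succ hg v s m hF]
    calc ∫⁻ x, F x * wordWeight g v s (m + 1) x ∂(Q.map covariates)
        = ∫⁻ x, F x * g (s + m) (v (s + m)) (pairing v x) * wordWeight g v s m x
              ∂(Q.map covariates) := by
          refine lintegral_congr fun x => ?_
          rw [wordWeight, wordWeight, Finset.prod_range_succ]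
          ring
      _ ≤ ENNReal.ofReal (Real.exp (∑ i ∈ Finset.range m, r i)) *
          ∫⁻ z in cyl (Ico s (s + m)) v,
            F (covariates z) * g (s + m) (v (s + m)) (pairing v (covariates z)) ∂Q :=
          ih (hF.mul hG)
      _ ≤ ENNReal.ofReal (Real.exp (∑ i ∈ Finset.range m, r i)) *
          ∫⁻ z in cyl (Ico s (s + m)) v, ENNReal.ofReal (Real.exp (r m)) *
            (F (covariates z) * g (s + m) (v (s + m)) z) ∂Q := by
          refine mul_le_mul_right (setLIntegral_mono' hcyl fun z hz => ?_) _
          rw [mul_left_comm]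
          gcongr
          refine hg.distortion (s + m) _ m (pairing v (covariates z)) z rfl fun u hu => ?_
          rw [add_sub_cancel_right] at hu
          exact (hz u hu).symm
      _ = _ := by
          rw [lintegral_const_mul' _ _ ENNReal.ofReal_ne_top, ← mul_assoc,
            ← ENNReal.ofReal_mul (Real.exp_nonneg _), ← Real.exp_add, Finset.sum_range_succ]

/-- Two finite Gibbs measures with the same covariates are comparable. -/
lemma IsGibbs.le_smul {Q Q' : Measure (ℤ → E × S)} [IsFiniteMeasure Q] [IsFiniteMeasure Q']
    (hg : IsSpec g r) (hQ : IsGibbs g Q) (hQ' : IsGibbs g Q')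
    (h : Q.map covariates = Q'.map covariates) :
    Q ≤ ENNReal.ofReal (Real.exp (2 * ∑' k, r k)) • Q' := by
  refine measure_le_of_localEvents ENNReal.ofReal_ne_top ?_
  rintro A ⟨N, hA⟩
  refine measure_le_of_cyl (finite_Ico _ _) (fun v B hB => ?_) hA
  obtain ⟨m, hm⟩ : ∃ m : ℕ, (N : ℤ) = -N + m := ⟨2 * N, by push_cast; ring⟩
  have hs : ∑ i ∈ Finset.range m, r i ≤ ∑' k, r k :=
    hg.summable.sum_le_tsum _ fun i _ => hg.nonneg i
  have hB' : Measurable (B.indicator (1 : (ℤ → S) → ℝ≥0∞)) := measurable_one.indicator hB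
  have hind : ∀ ν : Measure (ℤ → E × S), ∀ C,
      ν (C ∩ covariates ⁻¹' B) = ∫⁻ z in C, B.indicator (1 : (ℤ → S) → ℝ≥0∞) (covariates z) ∂ν := by
    intro ν C
    have : (fun z : ℤ → E × S => B.indicator (1 : (ℤ → S) → ℝ≥0∞) (covariates z)) =
        (covariates ⁻¹' B).indicator 1 := by
      ext z; simp [indicator, mem_preimage]; rfl
    rw [this, lintegral_indicator_one (measurable_covariates hB),
      Measure.restrict_apply (measurable_covariates hB), inter_comm]
  have hN : Ico (-(N : ℤ)) N = Ico (-(N : ℤ)) (-N + m) := by rw [← hm]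
  rw [hN, hind, hind]
  -- Both cylinder probabilities are compared with the same integral of `wordWeight` against the
  -- common covariate law; each comparison costs at most `exp (∑' k, r k)`.
  calc _ ≤ _ := hQ.setLIntegral_cyl_le hg v (-N) m hB'
    _ ≤ _ := mul_le_mul_right (h ▸ hQ'.le_setLIntegral_cyl hg v (-N) m hB') _
    _ ≤ _ := by
      rw [← mul_assoc, ← ENNReal.ofReal_mul (Real.exp_nonneg _), ← Real.exp_add]
      gcongr
      linarith

/-- A finite Gibbs measure is determined by the law of its covariates. -/
theorem IsGibbs.eq_of_map_covariates_eq {Q Q' : Measure (ℤ → E × S)} [IsFiniteMeasure Q]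
    [IsFiniteMeasure Q'] (hg : IsSpec g r) (hQ : IsGibbs g Q) (hQ' : IsGibbs g Q')
    (h : Q.map covariates = Q'.map covariates) : Q = Q' := by
  have huniv : Q univ = Q' univ := by
    have := congrArg (fun R => R univ) h
    simpa [Measure.map_apply measurable_covariates MeasurableSet.univ] using this
  -- The inverse of the constant in `IsGibbs.le_smul`, which turns that upper bound into a lower
  -- one.
  set δ : ℝ := Real.exp (-(2 * ∑' k, r k)) with hδ
  have hδ0 : 0 < δ := Real.exp_pos _
  have hδ1 : δ ≤ 1 := by
    rw [hδ, Real.exp_le_one_iff]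
    have : 0 ≤ ∑' k, r k := tsum_nonneg hg.nonneg
    linarith
  -- a comparable lower bound
  have lower : ∀ {R R' : Measure (ℤ → E × S)} [IsFiniteMeasure R] [IsFiniteMeasure R'],
      IsGibbs g R → IsGibbs g R' → R.map covariates = R'.map covariates →
      ENNReal.ofReal δ • R' ≤ R := by
    intro R R' _ _ hR hR' hRR'
    have h1 := hR'.le_smul hg hR hRR'.symm
    refine Measure.le_iff'.2 fun A => ?_
    have h2 := Measure.le_iff'.1 h1 A
    rw [Measure.smul_apply, smul_eq_mul] at h2 ⊢
    calc _ ≤ ENNReal.ofReal δ * _ := mul_le_mul_right h2 _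
      _ = _ := by
        rw [← mul_assoc, ← ENNReal.ofReal_mul hδ0.le, hδ, ← Real.exp_add]
        simp
  -- With `a = (1 - δ) ^ k`, the remainder `Q - (1 - a) Q'` is Gibbs with the covariate law of `a
  -- Q'`, so it dominates `δ a Q'`. Each round therefore multiplies the missing mass by `1 - δ`.
  have iter : ∀ k : ℕ, ENNReal.ofReal (1 - (1 - δ) ^ k) • Q' ≤ Q := by
    intro k
    induction k with
    | zero => simpa using Measure.zero_le Q
    | succ k ih =>
      have ha0 : 0 ≤ (1 - δ) ^ k := pow_nonneg (by linarith) k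
      have ha1 : (1 - δ) ^ k ≤ 1 := pow_le_one₀ (by linarith) (by linarith)
      set a := (1 - δ) ^ k with ha
      have hfin : IsFiniteMeasure (ENNReal.ofReal (1 - a) • Q') :=
        Q'.smul_finite ENNReal.ofReal_ne_top
      have hfin' : IsFiniteMeasure (ENNReal.ofReal a • Q') := Q'.smul_finite ENNReal.ofReal_ne_top
      have hsub := Measure.sub_add_cancel_of_le ih
      set R := Q - ENNReal.ofReal (1 - a) • Q' with hR
      have hRG : IsGibbs g R :=
        IsGibbs.of_add hg (hQ'.smul (ENNReal.ofReal (1 - a))) (by rwa [hsub])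
      have hRm : R.map covariates = (ENNReal.ofReal a • Q').map covariates := by
        have h1 : R.map covariates + (ENNReal.ofReal (1 - a) • Q').map covariates =
            (ENNReal.ofReal a • Q').map covariates +
              (ENNReal.ofReal (1 - a) • Q').map covariates := by
          rw [← Measure.map_add _ _ measurable_covariates, hsub, h,
            ← Measure.map_add _ _ measurable_covariates, ← add_smul,
            ← ENNReal.ofReal_add ha0 (by linarith)]
          simp
        refine Measure.ext fun B hB => ?_
        have h2 := congrArg (fun R => R B) h1
        simp only [Measure.add_apply] at h2
        exact (ENNReal.add_left_inj (measure_ne_top _ _)).1 h2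
      have h3 := lower hRG (hQ'.smul (ENNReal.ofReal a)) hRm
      calc ENNReal.ofReal (1 - (1 - δ) ^ (k + 1)) • Q'
          = ENNReal.ofReal δ • (ENNReal.ofReal a • Q') + ENNReal.ofReal (1 - a) • Q' := by
            rw [smul_smul, ← add_smul, ← ENNReal.ofReal_mul hδ0.le,
              ← ENNReal.ofReal_add (by positivity) (by linarith), pow_succ, ← ha]
            congr 2
            ring
        _ ≤ R + ENNReal.ofReal (1 - a) • Q' := add_le_add_left h3 _
        _ = Q := hsub
  have hle : Q' ≤ Q := by
    refine Measure.le_iff'.2 fun A => ?_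
    have hlim : Tendsto (fun k : ℕ => ENNReal.ofReal (1 - (1 - δ) ^ k) * Q' A) atTop
        (𝓝 (ENNReal.ofReal (1 - 0) * Q' A)) := by
      refine ENNReal.Tendsto.mul_const (ENNReal.tendsto_ofReal (tendsto_const_nhds.sub ?_))
        (Or.inr (measure_ne_top _ _))
      exact tendsto_pow_atTop_nhds_zero_of_lt_one (by linarith) (by linarith)
    simp only [sub_zero, ENNReal.ofReal_one, one_mul] at hlim
    exact le_of_tendsto' hlim fun k => Measure.le_iff'.1 (iter k) A
  exact (Measure.eq_of_le_of_measure_univ_eq hle huniv.symm).symm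

end Gibbs

/-! ### Sequential drawing of categories on a finite interval. -/

section Resample

variable {E S : Type*} [MeasurableSpace E] [MeasurableSpace S] [Inhabited E] [Inhabited S]
  [Fintype E] [MeasurableSingletonClass E] {g : ℤ → E → (ℤ → E × S) → ℝ≥0∞} {r : ℕ → ℝ}

/-- The Gibbs property at time `t` only. -/
def IsGibbsAt (g : ℤ → E → (ℤ → E × S) → ℝ≥0∞) (Q : Measure (ℤ → E × S)) (t : ℤ) : Prop :=
  ∀ (y : E) (A : Set (ℤ → E × S)), MeasurableSet[window (Iio t) univ] A →
    Q (A ∩ {z | (z t).1 = y}) = ∫⁻ z in A, g t y z ∂Q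

/-- Replace the category at time `t`. -/
def setCategory (t : ℤ) (y : E) (z : ℤ → E × S) : ℤ → E × S :=
  Function.update z t (y, (z t).2)

lemma measurable_setCategory (t : ℤ) (y : E) : Measurable (setCategory (S := S) t y) := by
  refine measurable_pi_lambda _ fun s => ?_
  by_cases h : s = t
  · subst h; simp only [setCategory, Function.update_self]; fun_prop
  · simp only [setCategory, Function.update_of_ne h]; fun_prop

lemma mask_setCategory {I J : Set ℤ} {t : ℤ} (ht : t ∉ I) (y : E) (z : ℤ → E × S) :
    mask I J (setCategory t y z) = mask I J z := by
  funext s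
  by_cases h : s = t
  · subst h; simp [mask, setCategory, ht]
  · simp [mask, setCategory, Function.update_of_ne h]

/-- Draw the category at time `t` again, from the conditional probabilities `g t`. -/
def resample (g : ℤ → E → (ℤ → E × S) → ℝ≥0∞) (t : ℤ) (Q : Measure (ℤ → E × S)) :
    Measure (ℤ → E × S) :=
  ∑ y, (Q.withDensity (g t y)).map (setCategory t y)

lemma resample_apply (t : ℤ) (Q : Measure (ℤ → E × S)) {A : Set (ℤ → E × S)}
    (hA : MeasurableSet A) :
    resample g t Q A = ∑ y, ∫⁻ z in setCategory t y ⁻¹' A, g t y z ∂Q := by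
  rw [resample, Measure.finsetSum_apply]
  refine Finset.sum_congr rfl fun y _ => ?_
  rw [Measure.map_apply (measurable_setCategory t y) hA,
    withDensity_apply _ (measurable_setCategory t y hA)]

lemma setCategory_preimage {I : Set ℤ} {J : Set ℤ} {t : ℤ} (ht : t ∉ I) (y : E)
    {A : Set (ℤ → E × S)} (hA : MeasurableSet[window I J] A) : setCategory t y ⁻¹' A = A := by
  obtain ⟨A', -, rfl⟩ := hA
  ext z
  simp [mask_setCategory ht]

/-- The window does not see the category at time `t`, and the weights of the possible new categories
sum to one. -/
lemma resample_apply_window (hg : IsSpec g r) (t : ℤ) (Q : Measure (ℤ → E × S))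
    {A : Set (ℤ → E × S)} (hA : MeasurableSet[window (Iio t) univ] A) :
    resample g t Q A = Q A := by
  rw [resample_apply _ _ (window_le _ _ _ hA)]
  simp only [setCategory_preimage (self_notMem_Iio) _ hA]
  rw [← lintegral_finsetSum _ fun y _ => hg.measurable t y]
  simp [hg.sum_eq_one]

lemma setLIntegral_resample (hg : IsSpec g r) (t : ℤ) (Q : Measure (ℤ → E × S))
    {A : Set (ℤ → E × S)} (hA : MeasurableSet[window (Iio t) univ] A)
    {F : (ℤ → E × S) → ℝ≥0∞} (hF : Measurable[window (Iio t) univ] F) :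
    ∫⁻ z in A, F z ∂(resample g t Q) = ∫⁻ z in A, F z ∂Q := by
  have hle := window_le (E := E) (S := S) (Iio t) univ
  have h : (resample g t Q).trim hle = Q.trim hle := by
    refine @Measure.ext _ (_) _ _ fun A hA => ?_
    rw [trim_measurableSet_eq hle hA, trim_measurableSet_eq hle hA,
      resample_apply_window hg t Q hA]
  rw [← lintegral_indicator (hle A hA), ← lintegral_trim hle (hF.indicator hA), h,
    lintegral_trim hle (hF.indicator hA), lintegral_indicator (hle A hA)]

lemma isGibbsAt_resample (hg : IsSpec g r) (t : ℤ) (Q : Measure (ℤ → E × S)) :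
    IsGibbsAt g (resample g t Q) t := by
  classical
  intro y A hA
  have hA' := window_le _ _ _ hA
  have hpre : ∀ y', setCategory t y' ⁻¹' (A ∩ {z : ℤ → E × S | (z t).1 = y}) =
      if y' = y then A else ∅ := by
    intro y'
    rw [preimage_inter, setCategory_preimage self_notMem_Iio _ hA]
    ext z
    by_cases h : y' = y <;> simp [setCategory, h]
  rw [resample_apply _ _ (hA'.inter (measurableSet_category t y)),
    setLIntegral_resample hg t Q hA (hg.measurable_window t y), Finset.sum_eq_single y]
  · rw [hpre, if_pos rfl]
  · intro y' _ hne
    rw [hpre, if_neg hne]; simp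
  · simp

/-- The property at time `s` involves categories up to time `s` only, all before `t`. Drawing in
increasing order of time therefore never destroys what was gained. -/
lemma IsGibbsAt.resample (hg : IsSpec g r) {s t : ℤ} (hst : s < t) {Q : Measure (ℤ → E × S)}
    (hQ : IsGibbsAt g Q s) : IsGibbsAt g (resample g t Q) s := by
  intro y A hA
  have hmono := window_mono (E := E) (S := S) (Iio_subset_Iio hst.le) (subset_refl univ)
  have h1 : MeasurableSet[window (Iio t) univ] {z : ℤ → E × S | (z s).1 = y} :=
    measurable_category_window univ (mem_Iio.2 hst) (measurableSet_singleton y)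
  rw [resample_apply_window hg t Q (MeasurableSet.inter (hmono _ hA) h1), hQ y A hA,
    setLIntegral_resample hg t Q (hmono _ hA) ((hg.measurable_window s y).mono hmono le_rfl)]

lemma map_covariates_resample (hg : IsSpec g r) (t : ℤ) (Q : Measure (ℤ → E × S)) :
    (resample g t Q).map covariates = Q.map covariates := by
  refine Measure.ext fun B hB => ?_
  rw [Measure.map_apply measurable_covariates hB, Measure.map_apply measurable_covariates hB,
    resample_apply_window hg t Q (measurable_covariates_window _ hB)]

/-- For every covariate law, there are measures that are Gibbs on a given finite time interval. -/
lemma exists_isGibbsAt (hg : IsSpec g r) (μ : Measure (ℤ → S)) (s : ℤ) (m : ℕ) :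
    ∃ Q : Measure (ℤ → E × S), Q.map covariates = μ ∧ ∀ t ∈ Ico s (s + m), IsGibbsAt g Q t := by
  induction m with
  | zero =>
    refine ⟨μ.map (pairing default), ?_, fun t ht => ?_⟩
    · rw [Measure.map_map measurable_covariates (measurable_pairing _)]
      exact Measure.map_id
    · simp at ht
  | succ m ih =>
    obtain ⟨Q, hQ, hQ'⟩ := ih
    refine ⟨resample g (s + m) Q, by rw [map_covariates_resample hg, hQ], fun t ht => ?_⟩
    have ht2 := ht.2
    push_cast at ht2
    rcases (show t ≤ s + m by omega).lt_or_eq with h | h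
    · exact (hQ' t ⟨ht.1, h⟩).resample hg h
    · rw [h]; exact isGibbsAt_resample hg _ Q

end Resample

/-! ### Existence of a Gibbs measure by weak compactness. -/

section Limit

variable {E S : Type*} [MeasurableSpace E] [MeasurableSpace S] [Inhabited E] [Inhabited S]
  [Fintype E] [MeasurableSingletonClass E]
  [TopologicalSpace E] [DiscreteTopology E] [BorelSpace E]
  [TopologicalSpace S] [PolishSpace S] [BorelSpace S]
  {g : ℤ → E → (ℤ → E × S) → ℝ≥0∞} {r : ℕ → ℝ}

lemma continuous_covariates : Continuous (covariates (E := E) (S := S)) := by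
  unfold covariates; fun_prop

lemma continuous_pairing :
    Continuous fun p : (ℤ → E) × (ℤ → S) => pairing p.1 p.2 := by
  unfold pairing; fun_prop

lemma isClopen_cyl {I : Set ℤ} (hI : I.Finite) (v : ℤ → E) : IsClopen (cyl (S := S) I v) := by
  have : cyl (S := S) I v = ⋂ s ∈ I, (fun z : ℤ → E × S => (z s).1) ⁻¹' {v s} := by
    ext z; simp [cyl]
  rw [this]
  refine hI.isClopen_biInter fun s _ => ?_
  exact (isClopen_discrete _).preimage (by fun_prop)

/-- Weak convergence with fixed law of the covariates gives convergence of the probabilities of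
the events in finitely many categories and in the covariates. -/
lemma tendsto_setIntegral_cyl {ι : Type*} {l : Filter ι} {R : ι → ProbabilityMeasure (ℤ → E × S)}
    {Q : ProbabilityMeasure (ℤ → E × S)} (hlim : Tendsto R l (𝓝 Q)) {μ : Measure (ℤ → S)}
    (hR : ∀ i, (R i : Measure (ℤ → E × S)).map covariates = μ)
    (hQ : (Q : Measure (ℤ → E × S)).map covariates = μ) {I : Set ℤ} (hI : I.Finite) (v : ℤ → E)
    {f : (ℤ → S) → ℝ} (hf : Integrable f μ) :
    Tendsto (fun i => ∫ z in cyl I v, f (covariates z) ∂(R i : Measure (ℤ → E × S))) l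
      (𝓝 (∫ z in cyl I v, f (covariates z) ∂(Q : Measure (ℤ → E × S)))) := by
  have hμ : IsProbabilityMeasure μ := by
    rw [← hQ]; exact Measure.isProbabilityMeasure_map measurable_covariates.aemeasurable
  have hcyl := isClopen_cyl (S := S) hI v
  rw [Metric.tendsto_nhds]
  intro ε hε
  -- Weak convergence tests continuous functions only, but the covariate law is the same for all the
  -- measures. One approximation in `L¹(μ)` is thus valid along the whole family, and cutting it by
  -- a clopen cylinder keeps it continuous.
  obtain ⟨φ, hφ, hφi⟩ := hf.exists_boundedContinuous_integral_sub_le (show 0 < ε / 4 by positivity)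
  let ψ : BoundedContinuousFunction (ℤ → E × S) ℝ :=
    BoundedContinuousFunction.ofNormedAddCommGroup
      ((cyl I v).indicator fun z => φ (covariates z))
      (hcyl.continuous_indicator (φ.continuous.comp continuous_covariates)) ‖φ‖ (fun z => by
        refine (norm_indicator_le_norm_self _ _).trans ?_
        exact φ.norm_coe_le_norm _)
  have key : ∀ P : Measure (ℤ → E × S), P.map covariates = μ →
      |∫ z in cyl I v, f (covariates z) ∂P - ∫ z, ψ z ∂P| ≤ ε / 4 := by
    intro P hP
    have h1 : ∫ z, ψ z ∂P = ∫ z in cyl I v, φ (covariates z) ∂P := by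
      rw [← integral_indicator hcyl.isOpen.measurableSet]; rfl
    have hfi : Integrable (fun z => f (covariates z)) P := by
      rw [← hP] at hf; exact hf.comp_measurable measurable_covariates
    have hφi' : Integrable (fun z => φ (covariates z)) P := by
      rw [← hP] at hφi; exact hφi.comp_measurable measurable_covariates
    rw [h1, ← integral_sub hfi.integrableOn hφi'.integrableOn]
    calc |∫ z in cyl I v, (f (covariates z) - φ (covariates z)) ∂P|
        ≤ ∫ z in cyl I v, ‖f (covariates z) - φ (covariates z)‖ ∂P :=
          (Real.norm_eq_abs _).symm.trans_le (norm_integral_le_integral_norm _)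
      _ ≤ ∫ z, ‖f (covariates z) - φ (covariates z)‖ ∂P :=
          setIntegral_le_integral (hfi.sub hφi').norm (ae_of_all _ fun _ => norm_nonneg _)
      _ = ∫ x, ‖f x - φ x‖ ∂μ := by
          rw [← hP, integral_map measurable_covariates.aemeasurable]
          rw [hP]; exact (hf.sub hφi).norm.aestronglyMeasurable
      _ ≤ ε / 4 := hφ
  have hψ := (ProbabilityMeasure.tendsto_iff_forall_integral_tendsto.1 hlim) ψ
  filter_upwards [(Metric.tendsto_nhds.1 hψ) (ε / 4) (by positivity)] with i hi
  have h1 := key _ (hR i)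
  have h2 := key _ hQ
  rw [Real.dist_eq] at hi ⊢
  rw [abs_le] at h1 h2
  rw [abs_lt] at hi ⊢
  constructor <;> linarith [hi.1, hi.2, h1.1, h1.2, h2.1, h2.2]

lemma tendsto_setLIntegral_cyl {ι : Type*} {l : Filter ι} {R : ι → ProbabilityMeasure (ℤ → E × S)}
    {Q : ProbabilityMeasure (ℤ → E × S)} (hlim : Tendsto R l (𝓝 Q)) {μ : Measure (ℤ → S)}
    (hR : ∀ i, (R i : Measure (ℤ → E × S)).map covariates = μ)
    (hQ : (Q : Measure (ℤ → E × S)).map covariates = μ) {I : Set ℤ} (hI : I.Finite) (v : ℤ → E)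
    {F : (ℤ → S) → ℝ≥0∞} (hF : Measurable F) (hF1 : ∀ x, F x ≤ 1) :
    Tendsto (fun i => ∫⁻ z in cyl I v, F (covariates z) ∂(R i : Measure (ℤ → E × S))) l
      (𝓝 (∫⁻ z in cyl I v, F (covariates z) ∂(Q : Measure (ℤ → E × S)))) := by
  have hμ : IsProbabilityMeasure μ := by
    rw [← hQ]; exact Measure.isProbabilityMeasure_map measurable_covariates.aemeasurable
  have hFt : ∀ x, F x < ∞ := fun x => (hF1 x).trans_lt ENNReal.one_lt_top
  have hFi : Integrable (fun x => (F x).toReal) μ := by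
    refine Integrable.of_bound hF.ennreal_toReal.aestronglyMeasurable 1 (ae_of_all _ fun x => ?_)
    rw [Real.norm_of_nonneg ENNReal.toReal_nonneg]
    exact ENNReal.toReal_le_of_le_ofReal zero_le_one (by simpa using hF1 x)
  have h := tendsto_setIntegral_cyl hlim hR hQ hI v hFi
  have conv : ∀ P : Measure (ℤ → E × S), IsFiniteMeasure P →
      ∫⁻ z in cyl I v, F (covariates z) ∂P =
        ENNReal.ofReal (∫ z in cyl I v, (F (covariates z)).toReal ∂P) := by
    intro P _
    rw [integral_toReal (f := fun z => F (covariates z))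
        (hF.comp measurable_covariates).aemeasurable (ae_of_all _ fun z => hFt _),
      ENNReal.ofReal_toReal]
    refine ((lintegral_mono fun z => hF1 _).trans_lt ?_).ne
    simp
  simp_rw [fun i => conv (R i : Measure (ℤ → E × S)) inferInstance,
    conv (Q : Measure (ℤ → E × S)) inferInstance]
  exact ENNReal.tendsto_ofReal h

/-- The space of category paths is compact since `E` is finite, so a compact set of covariate paths
carrying most of `μ` suffices for all the measures. -/
lemma isTightMeasureSet_of_map_covariates (μ : Measure (ℤ → S)) [IsFiniteMeasure μ]
    (𝒬 : Set (Measure (ℤ → E × S))) (h : ∀ Q ∈ 𝒬, Q.map covariates = μ) :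
    IsTightMeasureSet 𝒬 := by
  rw [isTightMeasureSet_iff_exists_isCompact_measure_compl_le]
  intro ε hε
  obtain ⟨K, hK, hKε⟩ := (isTightMeasureSet_iff_exists_isCompact_measure_compl_le.1
    (isTightMeasureSet_singleton (μ := μ))) ε hε
  refine ⟨(fun p : (ℤ → E) × (ℤ → S) => pairing p.1 p.2) '' (univ ×ˢ K),
    (isCompact_univ.prod hK).image continuous_pairing, fun Q hQ => ?_⟩
  calc Q _ ≤ Q (covariates ⁻¹' Kᶜ) := by
        refine measure_mono fun z hz hz' => hz ?_
        exact ⟨(fun s => (z s).1, covariates z), ⟨mem_univ _, hz'⟩, rfl⟩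
    _ = μ Kᶜ := by
        rw [← h Q hQ, Measure.map_apply measurable_covariates hK.measurableSet.compl]
    _ ≤ ε := hKε μ rfl

lemma isPiSystem_pastEvents (t : ℤ) : IsPiSystem
    {A : Set (ℤ → E × S) | ∃ k : ℕ, MeasurableSet[window (Ico (t - k) t) univ] A} := by
  rintro A ⟨k, hA⟩ B ⟨m, hB⟩ -
  refine ⟨max k m, MeasurableSet.inter (window_mono ?_ subset_rfl _ hA)
    (window_mono ?_ subset_rfl _ hB)⟩ <;>
  · refine Ico_subset_Ico ?_ le_rfl
    push_cast
    omega

lemma window_Iio_eq_generateFrom (t : ℤ) : window (E := E) (S := S) (Iio t) univ =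
    MeasurableSpace.generateFrom
      {A | ∃ k : ℕ, MeasurableSet[window (Ico (t - k) t) univ] A} := by
  apply le_antisymm
  · have hle : ∀ k : ℕ, window (E := E) (S := S) (Ico (t - k) t) univ ≤
        MeasurableSpace.generateFrom
          {A | ∃ k : ℕ, MeasurableSet[window (Ico (t - k) t) univ] A} :=
      fun k A hA => MeasurableSpace.measurableSet_generateFrom ⟨k, hA⟩
    rw [window_eq_sigmaGen]
    refine sup_le (iSup₂_le fun s hs => ?_) (iSup₂_le fun s hs => ?_)
    · have hs' : s ∈ Ico (t - ((t - s).toNat : ℤ)) t := ⟨by have := mem_Iio.1 hs; omega, hs⟩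
      exact (measurable_category_window univ hs').comap_le.trans (hle (t - s).toNat)
    · exact (measurable_covariate_window _ (mem_univ s)).comap_le.trans (hle 0)
  · refine MeasurableSpace.generateFrom_le ?_
    rintro A ⟨k, hA⟩
    exact window_mono Ico_subset_Iio_self subset_rfl _ hA

lemma cyl_inter_category (t : ℤ) (k : ℕ) (v : ℤ → E) (y : E) :
    cyl (S := S) (Ico (t - k) t) v ∩ {z | (z t).1 = y} =
      cyl (insert t (Ico (t - k) t)) (Function.update v t y) := by
  ext z
  simp only [cyl, mem_inter_iff, mem_ofPred_eq, forall_mem_insert, Function.update_self]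
  rw [and_comm]
  refine and_congr_right fun _ => forall₂_congr fun s hs => ?_
  rw [Function.update_of_ne hs.2.ne]

/-- The Gibbs property passes to weak limits with fixed law of the covariates. -/
lemma isGibbsAt_of_tendsto (hg : IsSpec g r) {ι : Type*} {l : Filter ι} [l.NeBot]
    {R : ι → ProbabilityMeasure (ℤ → E × S)}
    {Q : ProbabilityMeasure (ℤ → E × S)} (hlim : Tendsto R l (𝓝 Q)) {μ : Measure (ℤ → S)}
    (hR : ∀ i, (R i : Measure (ℤ → E × S)).map covariates = μ)
    (hQ : (Q : Measure (ℤ → E × S)).map covariates = μ) {t : ℤ}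
    (hG : ∀ᶠ i in l, IsGibbsAt g (R i : Measure (ℤ → E × S)) t) :
    IsGibbsAt g (Q : Measure (ℤ → E × S)) t := by
  intro y A hA
  -- The kernel depends on infinitely many categories and is only measurable in the covariates, so
  -- the limit cannot be taken in it directly. On the cylinder of a word of length `k` it is
  -- replaced by a function of the covariates alone, at the cost of a factor `c k`, which tends to
  -- one.
  set c : ℕ → ℝ≥0∞ := fun k => ENNReal.ofReal (Real.exp (r k)) with hc
  set ν : Measure (ℤ → E × S) := (Q : Measure (ℤ → E × S)).restrict {z | (z t).1 = y} with hν
  set ν' : Measure (ℤ → E × S) := (Q : Measure (ℤ → E × S)).withDensity (g t y) with hν'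
  have hν'f : IsFiniteMeasure ν' := by
    refine ⟨?_⟩
    rw [hν', withDensity_apply _ MeasurableSet.univ]
    exact (hg.setLIntegral_ne_top _ t y univ).lt_top
  have hcylm : ∀ k v, MeasurableSet (cyl (S := S) (Ico (t - (k : ℕ)) t) v) := fun k v =>
    window_le _ univ _ (measurableSet_cyl (E := E) _ subset_rfl v)
  have hbar : ∀ v : ℤ → E, Measurable fun x : ℤ → S => g t y (pairing v x) := fun v =>
    (hg.measurable t y).comp (measurable_pairing v)
  -- comparison of the integral of the conditional probability with that of its local version
  have up : ∀ (P : Measure (ℤ → E × S)) (k : ℕ) (v : ℤ → E) (B : Set (ℤ → S)), MeasurableSet B →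
      ∫⁻ z in cyl (Ico (t - k) t) v ∩ covariates ⁻¹' B, g t y z ∂P ≤ c k *
        ∫⁻ z in cyl (Ico (t - k) t) v, B.indicator (fun x => g t y (pairing v x)) (covariates z)
          ∂P := by
    intro P k v B hB
    rw [← lintegral_const_mul' _ _ ENNReal.ofReal_ne_top,
      ← lintegral_indicator ((hcylm k v).inter (measurable_covariates hB)),
      ← lintegral_indicator (hcylm k v)]
    refine lintegral_mono fun z => ?_
    by_cases hz : z ∈ cyl (S := S) (Ico (t - k) t) v
    · by_cases hz' : covariates z ∈ B
      · rw [indicator_of_mem (show z ∈ _ ∩ _ from ⟨hz, hz'⟩), indicator_of_mem hz,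
          indicator_of_mem hz']
        exact hg.distortion t y k z (pairing v (covariates z)) rfl hz
      · rw [indicator_of_notMem fun h => hz' h.2]; exact zero_le
    · rw [indicator_of_notMem fun h => hz h.1]; exact zero_le
  have down : ∀ (P : Measure (ℤ → E × S)) (k : ℕ) (v : ℤ → E) (B : Set (ℤ → S)), MeasurableSet B →
      ∫⁻ z in cyl (Ico (t - k) t) v, B.indicator (fun x => g t y (pairing v x)) (covariates z)
          ∂P ≤ c k * ∫⁻ z in cyl (Ico (t - k) t) v ∩ covariates ⁻¹' B, g t y z ∂P := by
    intro P k v B hB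
    rw [← lintegral_const_mul' _ _ ENNReal.ofReal_ne_top,
      ← lintegral_indicator ((hcylm k v).inter (measurable_covariates hB)),
      ← lintegral_indicator (hcylm k v)]
    refine lintegral_mono fun z => ?_
    by_cases hz : z ∈ cyl (S := S) (Ico (t - k) t) v
    · rw [indicator_of_mem hz]
      by_cases hz' : covariates z ∈ B
      · rw [indicator_of_mem (show z ∈ _ ∩ _ from ⟨hz, hz'⟩), indicator_of_mem hz']
        exact hg.distortion t y k (pairing v (covariates z)) z rfl fun s hs => (hz s hs).symm
      · rw [indicator_of_notMem hz']; exact zero_le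
    · rw [indicator_of_notMem hz]; exact zero_le
  have lim1 : ∀ (k : ℕ) (v : ℤ → E) (B : Set (ℤ → S)), MeasurableSet B →
      Tendsto (fun i => (R i : Measure (ℤ → E × S))
        (cyl (Ico (t - k) t) v ∩ covariates ⁻¹' B ∩ {z | (z t).1 = y})) l
        (𝓝 ((Q : Measure (ℤ → E × S))
          (cyl (Ico (t - k) t) v ∩ covariates ⁻¹' B ∩ {z | (z t).1 = y}))) := by
    intro k v B hB
    have h := tendsto_setLIntegral_cyl hlim hR hQ ((finite_Ico (t - (k : ℤ)) t).insert t)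
      (Function.update v t y) (F := B.indicator 1) (measurable_one.indicator hB)
      (fun x => indicator_le_self' (fun _ _ => zero_le) x)
    have conv : ∀ P : Measure (ℤ → E × S),
        ∫⁻ z in cyl (insert t (Ico (t - (k : ℤ)) t)) (Function.update v t y),
          B.indicator (1 : (ℤ → S) → ℝ≥0∞) (covariates z) ∂P =
        P (cyl (Ico (t - k) t) v ∩ covariates ⁻¹' B ∩ {z | (z t).1 = y}) := by
      intro P
      have : (fun z : ℤ → E × S => B.indicator (1 : (ℤ → S) → ℝ≥0∞) (covariates z)) =
          (covariates ⁻¹' B).indicator 1 := by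
        ext z; simp [indicator, mem_preimage]; rfl
      rw [this, lintegral_indicator_one (measurable_covariates hB),
        Measure.restrict_apply (measurable_covariates hB), ← cyl_inter_category]
      congr 1
      ext z
      simp only [mem_inter_iff]
      tauto
    simpa only [conv] using h
  have lim2 : ∀ (k : ℕ) (v : ℤ → E) (B : Set (ℤ → S)), MeasurableSet B →
      Tendsto (fun i => ∫⁻ z in cyl (Ico (t - k) t) v,
          B.indicator (fun x => g t y (pairing v x)) (covariates z) ∂(R i : Measure (ℤ → E × S))) l
        (𝓝 (∫⁻ z in cyl (Ico (t - k) t) v,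
          B.indicator (fun x => g t y (pairing v x)) (covariates z)
            ∂(Q : Measure (ℤ → E × S)))) := by
    intro k v B hB
    refine tendsto_setLIntegral_cyl hlim hR hQ (finite_Ico (t - (k : ℤ)) t) v
      ((hbar v).indicator hB) fun x => ?_
    exact (indicator_le_self' (fun _ _ => zero_le) x).trans (hg.le_one t y _)
  have gibbs : ∀ (k : ℕ) (v : ℤ → E) (B : Set (ℤ → S)), MeasurableSet B → ∀ᶠ i in l,
      (R i : Measure (ℤ → E × S)) (cyl (Ico (t - k) t) v ∩ covariates ⁻¹' B ∩ {z | (z t).1 = y}) =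
        ∫⁻ z in cyl (Ico (t - k) t) v ∩ covariates ⁻¹' B, g t y z
          ∂(R i : Measure (ℤ → E × S)) := by
    intro k v B hB
    filter_upwards [hG] with i hi
    exact hi y _ (MeasurableSet.inter (measurableSet_cyl _ Ico_subset_Iio_self v)
      (measurable_covariates_window _ hB))
  have ne_top : ∀ k, c k ≠ ∞ := fun k => ENNReal.ofReal_ne_top
  -- One factor `c k` localises the kernel under `R i` before the limit, the other restores it under
  -- `Q` afterwards.
  have hνν' : ∀ (k : ℕ) (v : ℤ → E) (B : Set (ℤ → S)), MeasurableSet B →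
      ν (cyl (Ico (t - k) t) v ∩ covariates ⁻¹' B) ≤
        (c k * c k) * ν' (cyl (Ico (t - k) t) v ∩ covariates ⁻¹' B) := by
    intro k v B hB
    have hm : MeasurableSet (cyl (S := S) (Ico (t - k) t) v ∩ covariates ⁻¹' B) :=
      (hcylm k v).inter (measurable_covariates hB)
    rw [hν, hν', Measure.restrict_apply hm, withDensity_apply _ hm, mul_assoc]
    refine le_trans ?_ (mul_le_mul_right (down _ k v B hB) _)
    refine le_of_tendsto_of_tendsto (lim1 k v B hB)
      (ENNReal.Tendsto.const_mul (lim2 k v B hB) (Or.inr (ne_top k))) ?_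
    filter_upwards [gibbs k v B hB] with i hi
    rw [hi]
    exact up _ k v B hB
  have hν'ν : ∀ (k : ℕ) (v : ℤ → E) (B : Set (ℤ → S)), MeasurableSet B →
      ν' (cyl (Ico (t - k) t) v ∩ covariates ⁻¹' B) ≤
        (c k * c k) * ν (cyl (Ico (t - k) t) v ∩ covariates ⁻¹' B) := by
    intro k v B hB
    have hm : MeasurableSet (cyl (S := S) (Ico (t - k) t) v ∩ covariates ⁻¹' B) :=
      (hcylm k v).inter (measurable_covariates hB)
    rw [hν, hν', Measure.restrict_apply hm, withDensity_apply _ hm, mul_assoc]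
    refine (up _ k v B hB).trans (mul_le_mul_right ?_ _)
    refine le_of_tendsto_of_tendsto (lim2 k v B hB)
      (ENNReal.Tendsto.const_mul (lim1 k v B hB) (Or.inr (ne_top k))) ?_
    filter_upwards [gibbs k v B hB] with i hi
    rw [hi]
    exact down _ k v B hB
  have hc1 : Tendsto (fun k => c k * c k) atTop (𝓝 1) := by
    have h0 : Tendsto c atTop (𝓝 1) := by
      have := ENNReal.tendsto_ofReal
        ((Real.continuous_exp.tendsto 0).comp hg.summable.tendsto_atTop_zero)
      simpa using this
    have := ENNReal.Tendsto.mul h0 (Or.inl one_ne_zero) h0 (Or.inl one_ne_zero)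
    simpa using this
  have eqloc : ∀ (k : ℕ) (C : Set (ℤ → E × S)), MeasurableSet[window (Ico (t - k) t) univ] C →
      ν C = ν' C := by
    intro k C hC
    -- The event stays fixed while the window grows, so the two inequalities hold with constants `c
    -- m * c m` tending to one.
    have hev : ∀ᶠ m : ℕ in atTop, MeasurableSet[window (Ico (t - m) t) univ] C := by
      filter_upwards [eventually_ge_atTop k] with m hm
      refine window_mono (Ico_subset_Ico ?_ le_rfl) subset_rfl _ hC
      omega
    have mulone : ∀ {a : ℝ≥0∞}, a ≠ ∞ → Tendsto (fun k => c k * c k * a) atTop (𝓝 a) := by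
      intro a ha
      have := ENNReal.Tendsto.mul_const hc1 (b := a) (Or.inr ha)
      simpa using this
    apply le_antisymm
    · refine ge_of_tendsto (mulone (measure_ne_top ν' C)) ?_
      filter_upwards [hev] with m hm
      exact measure_le_of_cyl (finite_Ico _ _) (hνν' m) hm
    · refine ge_of_tendsto (mulone (measure_ne_top ν C)) ?_
      filter_upwards [hev] with m hm
      exact measure_le_of_cyl (finite_Ico _ _) (hν'ν m) hm
  have hle := window_le (E := E) (S := S) (Iio t) univ
  have htrim : ν.trim hle = ν'.trim hle := by
    have hf : IsFiniteMeasure (ν.trim hle) := isFiniteMeasure_trim hle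
    refine ext_of_generate_finite _ (window_Iio_eq_generateFrom t) (isPiSystem_pastEvents t) ?_ ?_
    · rintro C ⟨k, hC⟩
      have hC' := window_mono Ico_subset_Iio_self subset_rfl _ hC
      rw [trim_measurableSet_eq hle hC', trim_measurableSet_eq hle hC', eqloc k C hC]
    · rw [trim_measurableSet_eq hle MeasurableSet.univ, trim_measurableSet_eq hle MeasurableSet.univ]
      exact eqloc 0 univ MeasurableSet.univ
  have h := congrArg (fun m => @Measure.toOuterMeasure _ (_) m A) htrim
  have h' : ν.trim hle A = ν'.trim hle A := h
  rw [trim_measurableSet_eq hle hA, trim_measurableSet_eq hle hA, hν, hν',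
    Measure.restrict_apply (hle A hA), withDensity_apply _ (hle A hA)] at h'
  exact h'

/-- For every law of the covariates, there is a Gibbs probability measure. -/
theorem exists_isGibbs (hg : IsSpec g r) (μ : Measure (ℤ → S)) [IsProbabilityMeasure μ] :
    ∃ Q : Measure (ℤ → E × S), IsProbabilityMeasure Q ∧ Q.map covariates = μ ∧ IsGibbs g Q := by
  choose R₀ hR₀ hR₀' using fun N : ℕ => exists_isGibbsAt hg μ (-(N : ℤ)) (2 * N)
  have hprob : ∀ N, IsProbabilityMeasure (R₀ N) := fun N => by
    refine ⟨?_⟩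
    have : (R₀ N).map covariates univ = 1 := by rw [hR₀]; exact measure_univ
    rwa [Measure.map_apply measurable_covariates MeasurableSet.univ] at this
  let R : ℕ → ProbabilityMeasure (ℤ → E × S) := fun N => ⟨R₀ N, hprob N⟩
  have hcomp : IsCompact (closure (range R)) := by
    refine isCompact_closure_of_isTightMeasureSet
      (isTightMeasureSet_of_map_covariates μ _ ?_)
    rintro _ ⟨_, ⟨N, rfl⟩, rfl⟩
    exact hR₀ N
  -- A limit along an ultrafilter finer than `atTop` needs only compactness and keeps every property
  -- that holds eventually.
  obtain ⟨Q, -, hQ⟩ := hcomp.ultrafilter_le_nhds' ((hyperfilter ℕ).map R)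
    (by
      refine mem_of_superset ?_ subset_closure
      exact Filter.mem_map.2 (Filter.mem_of_superset univ_mem fun N _ => mem_range_self (f := R) N))
  have hlim : Tendsto R (hyperfilter ℕ : Filter ℕ) (𝓝 Q) := hQ
  have hQμ : (Q : Measure (ℤ → E × S)).map covariates = μ := by
    have h1 := ProbabilityMeasure.tendsto_map_of_tendsto_of_continuous R Q hlim
      continuous_covariates
    have h2 : ∀ N, (R N).map continuous_covariates.measurable.aemeasurable =
        (⟨μ, inferInstance⟩ : ProbabilityMeasure (ℤ → S)) := fun N => Subtype.ext (hR₀ N)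
    exact congrArg (fun P : ProbabilityMeasure (ℤ → S) => (P : Measure (ℤ → S)))
      (tendsto_nhds_unique h1 (tendsto_const_nhds.congr fun N => (h2 N).symm))
  refine ⟨Q, inferInstance, hQμ, fun t => ?_⟩
  refine isGibbsAt_of_tendsto hg hlim hR₀ hQμ ?_
  have hev : ∀ᶠ N : ℕ in atTop, IsGibbsAt g (R N : Measure (ℤ → E × S)) t := by
    filter_upwards [eventually_ge_atTop (t.natAbs + 1)] with N hN
    refine hR₀' N t ⟨?_, ?_⟩ <;> push_cast <;> omega
  exact hev.filter_mono (Nat.hyperfilter_le_atTop)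

end Limit

/-! ### Integer shifts of two-sided sequences. -/

section Shift

/-- The shift by `k` on two-sided sequences. -/
def shiftBy {S : Type*} (k : ℤ) (z : ℤ → S) : ℤ → S := fun s => z (s + k)

variable {S : Type*} [MeasurableSpace S]

lemma measurable_shiftBy (k : ℤ) : Measurable (shiftBy (S := S) k) := by
  unfold shiftBy; fun_prop

lemma shiftBy_shiftBy (k m : ℤ) (z : ℤ → S) : shiftBy k (shiftBy m z) = shiftBy (k + m) z := by
  funext s; simp [shiftBy, add_assoc]

lemma shiftBy_zero (z : ℤ → S) : shiftBy 0 z = z := by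
  funext s; simp [shiftBy]

lemma measurePreserving_shiftBy {Q : Measure (ℤ → S)} (h : MeasurePreserving shift Q Q) (k : ℤ) :
    MeasurePreserving (shiftBy k) Q Q := by
  have hnat : ∀ m : ℕ, MeasurePreserving (shiftBy (m : ℤ)) Q Q := by
    intro m
    induction m with
    | zero =>
      have : shiftBy ((0 : ℕ) : ℤ) = (id : (ℤ → S) → ℤ → S) := funext fun z => shiftBy_zero z
      rw [this]
      exact MeasurePreserving.id Q
    | succ m ih =>
      have : shiftBy ((m + 1 : ℕ) : ℤ) = (shift : (ℤ → S) → ℤ → S) ∘ shiftBy (m : ℤ) := by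
        funext z s
        simp only [shiftBy, shift, Function.comp]
        congr 1
        push_cast
        ring
      rw [this]
      exact h.comp ih
  rcases k.eq_nat_or_neg with ⟨m, rfl | rfl⟩
  · exact hnat m
  · refine ⟨measurable_shiftBy _, Measure.ext fun A hA => ?_⟩
    rw [Measure.map_apply (measurable_shiftBy _) hA,
      ← (hnat m).measure_preimage (measurable_shiftBy _ hA).nullMeasurableSet, ← preimage_comp]
    congr 1
    ext z
    simp [shiftBy_shiftBy, shiftBy_zero]

lemma shiftBy_preimage_of_shift_preimage {A : Set (ℤ → S)} (h : shift ⁻¹' A = A) (k : ℤ) :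
    shiftBy k ⁻¹' A = A := by
  have hnat : ∀ m : ℕ, shiftBy (m : ℤ) ⁻¹' A = A := by
    intro m
    induction m with
    | zero => ext z; simp [shiftBy_zero]
    | succ m ih =>
      have : shiftBy ((m + 1 : ℕ) : ℤ) = (shift : (ℤ → S) → ℤ → S) ∘ shiftBy (m : ℤ) := by
        funext z s
        simp only [shiftBy, shift, Function.comp]
        congr 1
        push_cast
        ring
      rw [this, preimage_comp, h, ih]
  rcases k.eq_nat_or_neg with ⟨m, rfl | rfl⟩
  · exact hnat m
  · conv_lhs => rw [← hnat m]
    ext z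
    simp [shiftBy_shiftBy, shiftBy_zero]

end Shift

/-! ### Stationarity and ergodicity of Gibbs measures. -/

section Stationary

variable {E S : Type*} [MeasurableSpace E] [MeasurableSpace S] [Inhabited E] [Inhabited S]
  {g : ℤ → E → (ℤ → E × S) → ℝ≥0∞} {r : ℕ → ℝ}

lemma measurableSet_shiftBy_preimage (a k : ℤ) {A : Set (ℤ → E × S)}
    (hA : MeasurableSet[window (Iio a) univ] A) :
    MeasurableSet[window (Iio (a + k)) univ] (shiftBy k ⁻¹' A) := by
  obtain ⟨A', hA', rfl⟩ := hA
  refine ⟨shiftBy k ⁻¹' A', measurable_shiftBy k hA', ?_⟩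
  rw [← preimage_comp, ← preimage_comp]
  congr 1
  funext z s
  simp [mask, shiftBy]

variable [Fintype E]

/-- The preimage of an event of the past of `t` lies in the past of `t + 1`, where the homogeneity
`heq` identifies the kernel. -/
lemma IsGibbs.map_shift (hg : IsSpec g r) (heq : ∀ t y z, g t y (shift z) = g (t + 1) y z)
    {Q : Measure (ℤ → E × S)} [MeasurableSingletonClass E] (hQ : IsGibbs g Q) :
    IsGibbs g (Q.map shift) := by
  intro t y A hA
  have hs : Measurable (shift : (ℤ → E × S) → ℤ → E × S) := measurable_shiftBy 1
  have hA' := window_le _ _ _ hA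
  rw [Measure.map_apply hs (hA'.inter (measurableSet_category t y)),
    setLIntegral_map hA' (hg.measurable t y) hs]
  simp only [heq]
  exact hQ (t + 1) y _ (measurableSet_shiftBy_preimage t 1 hA)

variable [MeasurableSingletonClass E]

/-- A Gibbs measure with stationary covariates is stationary. -/
theorem IsGibbs.measurePreserving_shift (hg : IsSpec g r)
    (heq : ∀ t y z, g t y (shift z) = g (t + 1) y z) {Q : Measure (ℤ → E × S)} [IsFiniteMeasure Q]
    (hQ : IsGibbs g Q) (hs : MeasurePreserving shift (Q.map covariates) (Q.map covariates)) :
    MeasurePreserving shift Q Q := by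
  have hm : Measurable (shift : (ℤ → E × S) → ℤ → E × S) := measurable_shiftBy 1
  refine ⟨hm, IsGibbs.eq_of_map_covariates_eq hg (hQ.map_shift hg heq) hQ ?_⟩
  conv_rhs => rw [← hs.map_eq]
  rw [Measure.map_map measurable_covariates hm, Measure.map_map hs.measurable measurable_covariates]
  rfl

/-- The restriction of a stationary Gibbs measure to an invariant event is Gibbs. -/
lemma IsGibbs.restrict (hg : IsSpec g r) {Q : Measure (ℤ → E × S)} [IsFiniteMeasure Q]
    (hQ : IsGibbs g Q) (hs : MeasurePreserving shift Q Q) {A : Set (ℤ → E × S)}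
    (hA : MeasurableSet A) (hinv : shift ⁻¹' A = A) : IsGibbs g (Q.restrict A) := by
  intro t y C hC
  have hC' := window_le _ _ _ hC
  set D := C ∩ {z : ℤ → E × S | (z t).1 = y}
  rw [Measure.restrict_apply (hC'.inter (measurableSet_category t y)),
    Measure.restrict_restrict hC']
  -- A local approximation with categories in `[-N, N)` is moved before time `t` by the shift `t -
  -- N`. Neither `A` nor `Q` changes under it, so the error is the same. The Gibbs identity can then
  -- be used on `C ∩ B` in place of `C ∩ A`.
  have happrox : ∀ ε : ℝ≥0∞, 0 < ε → ∃ B, MeasurableSet[window (Iio t) univ] B ∧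
      Q (B \ A) ≤ ε ∧ Q (A \ B) ≤ ε := by
    intro ε hε
    obtain ⟨B, ⟨N, hB⟩, hBε⟩ := exists_localEvents_symmDiff_lt Q hA hε
    have hB' : MeasurableSet B := window_le _ _ _ hB
    have h1 := measurableSet_shiftBy_preimage N (t - N)
      (window_mono Ico_subset_Iio_self subset_rfl _ hB)
    rw [add_sub_cancel] at h1
    have hp := measurePreserving_shiftBy hs (t - N)
    have hAk := shiftBy_preimage_of_shift_preimage hinv (t - N)
    refine ⟨_, h1, ?_, ?_⟩
    · rw [← hAk, ← preimage_sdiff, hp.measure_preimage (hB'.diff hA).nullMeasurableSet]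
      exact (measure_mono subset_union_left).trans hBε.le
    · rw [← hAk, ← preimage_sdiff, hp.measure_preimage (hA.diff hB').nullMeasurableSet]
      exact (measure_mono subset_union_right).trans hBε.le
  have hint : ∀ U V : Set (ℤ → E × S), MeasurableSet U → ∫⁻ z in U, g t y z ∂Q ≤
      ∫⁻ z in V, g t y z ∂Q + Q (U \ V) := by
    intro U V hU
    calc ∫⁻ z in U, g t y z ∂Q ≤ ∫⁻ z in V ∪ U \ V, g t y z ∂Q :=
          lintegral_mono_set (by rw [union_sdiff_self]; exact subset_union_right)
      _ ≤ ∫⁻ z in V, g t y z ∂Q + ∫⁻ z in U \ V, g t y z ∂Q := lintegral_union_le _ _ _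
      _ ≤ ∫⁻ z in V, g t y z ∂Q + ∫⁻ z in U \ V, 1 ∂Q := by
          gcongr; exact hg.le_one t y _
      _ = _ := by simp
  have hmes : ∀ U V : Set (ℤ → E × S), Q U ≤ Q V + Q (U \ V) := fun U V =>
    (measure_mono (by rw [union_sdiff_self]; exact subset_union_right)).trans
      (measure_union_le V (U \ V))
  apply le_antisymm
  · refine ENNReal.le_of_forall_pos_le_add fun ε hε _ => ?_
    obtain ⟨B, hB, hB1, hB2⟩ := happrox ((ε / 2 : ℝ≥0) : ℝ≥0∞) (by simpa using hε.ne')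
    calc Q (D ∩ A) ≤ Q (C ∩ B ∩ {z | (z t).1 = y}) + Q ((D ∩ A) \ (C ∩ B ∩ {z | (z t).1 = y})) :=
          hmes _ _
      _ ≤ Q (C ∩ B ∩ {z | (z t).1 = y}) + Q (A \ B) := by
          refine add_le_add le_rfl (measure_mono ?_)
          rintro z ⟨⟨⟨h1, h2⟩, h3⟩, h4⟩
          exact ⟨h3, fun h5 => h4 ⟨⟨h1, h5⟩, h2⟩⟩
      _ = ∫⁻ z in C ∩ B, g t y z ∂Q + Q (A \ B) := by
          rw [hQ t y _ (MeasurableSet.inter hC hB)]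
      _ ≤ (∫⁻ z in C ∩ A, g t y z ∂Q + Q ((C ∩ B) \ (C ∩ A))) + Q (A \ B) := by
          gcongr
          exact hint _ _ (hC'.inter (window_le _ _ _ hB))
      _ ≤ (∫⁻ z in C ∩ A, g t y z ∂Q + Q (B \ A)) + Q (A \ B) := by
          refine add_le_add (add_le_add le_rfl (measure_mono ?_)) le_rfl
          rintro z ⟨⟨h1, h2⟩, h3⟩
          exact ⟨h2, fun h => h3 ⟨h1, h⟩⟩
      _ ≤ (∫⁻ z in C ∩ A, g t y z ∂Q + ((ε / 2 : ℝ≥0) : ℝ≥0∞)) + ((ε / 2 : ℝ≥0) : ℝ≥0∞) := by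
          gcongr
      _ = _ := by rw [add_assoc, ← ENNReal.coe_add, add_halves]
  · refine ENNReal.le_of_forall_pos_le_add fun ε hε _ => ?_
    obtain ⟨B, hB, hB1, hB2⟩ := happrox ((ε / 2 : ℝ≥0) : ℝ≥0∞) (by simpa using hε.ne')
    calc ∫⁻ z in C ∩ A, g t y z ∂Q
        ≤ ∫⁻ z in C ∩ B, g t y z ∂Q + Q ((C ∩ A) \ (C ∩ B)) := hint _ _ (hC'.inter hA)
      _ ≤ ∫⁻ z in C ∩ B, g t y z ∂Q + Q (A \ B) := by
          refine add_le_add le_rfl (measure_mono ?_)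
          rintro z ⟨⟨h1, h2⟩, h3⟩
          exact ⟨h2, fun h => h3 ⟨h1, h⟩⟩
      _ = Q (C ∩ B ∩ {z | (z t).1 = y}) + Q (A \ B) := by
          rw [hQ t y _ (MeasurableSet.inter hC hB)]
      _ ≤ (Q (D ∩ A) + Q ((C ∩ B ∩ {z | (z t).1 = y}) \ (D ∩ A))) + Q (A \ B) := by
          gcongr
          exact hmes _ _
      _ ≤ (Q (D ∩ A) + Q (B \ A)) + Q (A \ B) := by
          refine add_le_add (add_le_add le_rfl (measure_mono ?_)) le_rfl
          rintro z ⟨⟨⟨h1, h2⟩, h3⟩, h4⟩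
          exact ⟨h2, fun h5 => h4 ⟨⟨h1, h3⟩, h5⟩⟩
      _ ≤ (Q (D ∩ A) + ((ε / 2 : ℝ≥0) : ℝ≥0∞)) + ((ε / 2 : ℝ≥0) : ℝ≥0∞) := by
          gcongr
      _ = _ := by rw [add_assoc, ← ENNReal.coe_add, add_halves]

/-- A Gibbs probability measure with ergodic covariates is ergodic. -/
theorem IsGibbs.ergodic (hg : IsSpec g r) (heq : ∀ t y z, g t y (shift z) = g (t + 1) y z)
    {Q : Measure (ℤ → E × S)} [IsProbabilityMeasure Q] (hQ : IsGibbs g Q)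
    (hs : Ergodic shift (Q.map covariates)) : Ergodic shift Q := by
  have hp := hQ.measurePreserving_shift hg heq hs.toMeasurePreserving
  have : IsProbabilityMeasure (Q.map covariates) :=
    Measure.isProbabilityMeasure_map measurable_covariates.aemeasurable
  refine ⟨hp, ⟨fun A hA hinv => ?_⟩⟩
  have hR : IsGibbs g (Q.restrict A) := hQ.restrict hg hp hA hinv
  have hRs : MeasurePreserving shift (Q.restrict A) (Q.restrict A) := by
    have := hp.restrict_preimage hA
    rwa [hinv] at this
  have hcs : MeasurePreserving shift ((Q.restrict A).map covariates)
      ((Q.restrict A).map covariates) := by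
    refine ⟨hs.measurable, ?_⟩
    conv_rhs => rw [← hRs.map_eq]
    rw [Measure.map_map measurable_covariates hRs.measurable,
      Measure.map_map hs.measurable measurable_covariates]
    rfl
  -- An invariant finite measure absolutely continuous with respect to an ergodic law is a multiple
  -- of it. Uniqueness of Gibbs measures lifts this proportionality from the covariates to the
  -- pairs.
  obtain ⟨c, hc⟩ := hs.eq_smul_of_absolutelyContinuous hcs
    ((Measure.absolutelyContinuous_of_le Measure.restrict_le_self).map measurable_covariates)
  have hc_ne : c ≠ ∞ := by
    intro h
    have h1 := congrArg (fun m => m univ) hc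
    simp only [Measure.smul_apply, measure_univ, smul_eq_mul, mul_one, h] at h1
    exact measure_ne_top _ _ h1
  have hfin : IsFiniteMeasure (c • Q) := Q.smul_finite hc_ne
  have hRQ : Q.restrict A = c • Q :=
    IsGibbs.eq_of_map_covariates_eq hg hR (hQ.smul c) (by rw [hc, Measure.map_smul])
  have h0 : c * Q Aᶜ = 0 := by
    have := congrArg (fun m => m Aᶜ) hRQ
    simpa [Measure.restrict_apply hA.compl] using this.symm
  rw [eventuallyConst_set]
  rcases mul_eq_zero.1 h0 with h | h
  · right
    have := congrArg (fun m => m A) hRQ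
    rw [h, zero_smul] at this
    simp only [Measure.restrict_apply_self, Measure.coe_zero, Pi.zero_apply] at this
    exact measure_eq_zero_iff_ae_notMem.1 this
  · left
    exact mem_ae_iff.2 h

end Stationary

/-! ### The linear recursion and its companion operator. -/

section Companion

variable {n q : ℕ}

/-- The block companion operator of the lag matrices `B`: it maps `(λ_{t-1}, …, λ_{t-q-1})` to
`(∑ j, B j λ_{t-1-j}, λ_{t-1}, …, λ_{t-q})`. -/
def companion {𝕜 : Type*} [CommRing 𝕜] (B : Fin q → Matrix (Fin n) (Fin n) 𝕜) :
    Module.End 𝕜 (Fin (q + 1) → Fin n → 𝕜) :=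
  LinearMap.pi (Fin.cons (α := fun _ => (Fin (q + 1) → Fin n → 𝕜) →ₗ[𝕜] Fin n → 𝕜)
    (∑ j, (B j).mulVecLin ∘ₗ LinearMap.proj j.castSucc) fun j => LinearMap.proj j.castSucc)

lemma companion_apply_zero {𝕜 : Type*} [CommRing 𝕜] (B : Fin q → Matrix (Fin n) (Fin n) 𝕜)
    (w : Fin (q + 1) → Fin n → 𝕜) :
    companion B w 0 = ∑ j, (B j).mulVec (w j.castSucc) := by
  simp [companion, LinearMap.sum_apply]

lemma companion_apply_succ {𝕜 : Type*} [CommRing 𝕜] (B : Fin q → Matrix (Fin n) (Fin n) 𝕜)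
    (w : Fin (q + 1) → Fin n → 𝕜) (j : Fin q) : companion B w j.succ = w j.castSucc := by
  simp [companion]

/-- The lower blocks of the eigenvalue equation force `w` to be `(v, μ⁻¹ v, μ⁻² v, …)` with `v ≠ 0`,
and the top block says that `v` is in the kernel of `I - ∑ B_j μ⁻ʲ`. The extra block beyond `q`
contributes only the eigenvalue zero and keeps a first block when `q = 0`. -/
lemma charFun_inv_eq_zero_of_eigenvector (B : Fin q → Matrix (Fin n) (Fin n) ℝ) {μ : ℂ}
    (hμ : μ ≠ 0) {w : Fin (q + 1) → Fin n → ℂ} (hw : w ≠ 0)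
    (h : companion (fun j => (B j).map (algebraMap ℝ ℂ)) w = μ • w) : charFun B μ⁻¹ = 0 := by
  have hpow : ∀ (k : ℕ) (hk : k < q + 1), w ⟨k, hk⟩ = μ⁻¹ ^ k • w 0 := by
    intro k
    induction k with
    | zero => intro hk; simp
    | succ k ih =>
      intro hk
      have h1 := congrFun h (Fin.succ ⟨k, by omega⟩)
      rw [companion_apply_succ, Pi.smul_apply] at h1
      have h2 : w ⟨k, by omega⟩ = μ • w ⟨k + 1, hk⟩ := h1
      rw [ih (by omega)] at h2
      rw [pow_succ, mul_comm, mul_smul, h2, smul_smul, inv_mul_cancel₀ hμ, one_smul]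
  have h0 : w 0 ≠ 0 := by
    intro h0
    refine hw (funext fun j => ?_)
    rw [show w j = _ from hpow j j.2, h0, smul_zero]
    rfl
  rw [charFun, ← Matrix.exists_mulVec_eq_zero_iff]
  refine ⟨w 0, h0, ?_⟩
  have h1 := congrFun h 0
  rw [companion_apply_zero, Pi.smul_apply] at h1
  have h2 : ∀ j : Fin q, w j.castSucc = μ⁻¹ ^ (j : ℕ) • w 0 := fun j =>
    hpow j (by omega)
  simp only [h2, Matrix.mulVec_smul] at h1
  rw [Matrix.sub_mulVec, Matrix.one_mulVec, Matrix.sum_mulVec, sub_eq_zero]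
  calc w 0 = μ⁻¹ • μ • w 0 := by rw [smul_smul, inv_mul_cancel₀ hμ, one_smul]
    _ = _ := by
      rw [← h1, Finset.smul_sum]
      refine Finset.sum_congr rfl fun j _ => ?_
      rw [Matrix.smul_mulVec, smul_smul, pow_succ, mul_comm]

/-- The powers of an operator of spectral radius less than one decay geometrically. -/
lemma exists_norm_pow_le_of_spectralRadius_lt_one {A : Type*} [NormedRing A] [NormedAlgebra ℂ A]
    [CompleteSpace A] {a : A} (ha : spectralRadius ℂ a < 1) :
    ∃ C ρ : ℝ, 0 < C ∧ 0 < ρ ∧ ρ < 1 ∧ ∀ k : ℕ, ‖a ^ k‖ ≤ C * ρ ^ k := by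
  obtain ⟨ρ, hρ1, hρ2⟩ := ENNReal.lt_iff_exists_nnreal_btwn.1 ha
  have hρ0 : 0 < (ρ : ℝ) := by
    have : (0 : ℝ≥0∞) < ρ := bot_le.trans_lt hρ1
    exact_mod_cast this
  have hρ1' : (ρ : ℝ) < 1 := by exact_mod_cast hρ2
  have hev := (spectrum.pow_nnnorm_pow_one_div_tendsto_nhds_spectralRadius a).eventually
    (gt_mem_nhds hρ1)
  obtain ⟨N, hN⟩ := eventually_atTop.1 (hev.and (eventually_gt_atTop 0))
  have hbound : ∀ k ≥ N, ‖a ^ k‖ ≤ (ρ : ℝ) ^ k := by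
    intro k hk
    obtain ⟨h1, h2⟩ := hN k hk
    have hk' : (k : ℝ) ≠ 0 := by exact_mod_cast h2.ne'
    have h3 := ENNReal.rpow_le_rpow h1.le (Nat.cast_nonneg (α := ℝ) k)
    rw [← ENNReal.rpow_mul, one_div_mul_cancel hk', ENNReal.rpow_one, ENNReal.rpow_natCast] at h3
    have h4 : ‖a ^ k‖₊ ≤ ρ ^ k := by exact_mod_cast h3
    exact_mod_cast h4
  -- Gelfand's formula handles `k ≥ N`, where the constant one suffices; the sum dominates each of
  -- the finitely many earlier ratios.
  refine ⟨1 + ∑ k ∈ Finset.range N, ‖a ^ k‖ / (ρ : ℝ) ^ k, ρ, by positivity, hρ0, hρ1',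
    fun k => ?_⟩
  have hpos : 0 < (ρ : ℝ) ^ k := by positivity
  rw [← div_le_iff₀ hpos]
  rcases lt_or_ge k N with hk | hk
  · have := Finset.single_le_sum (f := fun k => ‖a ^ k‖ / (ρ : ℝ) ^ k)
      (fun i _ => by positivity) (Finset.mem_range.2 hk)
    linarith
  · have h1 : ‖a ^ k‖ / (ρ : ℝ) ^ k ≤ 1 := (div_le_one hpos).2 (hbound k hk)
    have h2 : 0 ≤ ∑ k ∈ Finset.range N, ‖a ^ k‖ / (ρ : ℝ) ^ k :=
      Finset.sum_nonneg fun i _ => by positivity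
    linarith

/-- If all roots of the characteristic function lie outside the closed unit disk, the powers of
the companion operator decay geometrically. -/
lemma exists_norm_companion_pow_le (B : Fin q → Matrix (Fin n) (Fin n) ℝ)
    (hB : ∀ z : ℂ, charFun B z = 0 → 1 < ‖z‖) :
    ∃ C σ : ℝ, 0 < C ∧ 0 < σ ∧ σ < 1 ∧ ∀ (k : ℕ) (w : Fin (q + 1) → Fin n → ℝ),
      ‖(companion B ^ k) w‖ ≤ C * (σ * σ) ^ k * ‖w‖ := by
  set Bc : Fin q → Matrix (Fin n) (Fin n) ℂ := fun j => (B j).map (algebraMap ℝ ℂ) with hBc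
  set T := Module.End.toContinuousLinearMap (Fin (q + 1) → Fin n → ℂ) (companion Bc) with hT
  have hspec : ∀ μ ∈ spectrum ℂ T, ‖μ‖₊ < 1 := by
    intro μ hμ
    rw [hT, AlgEquiv.spectrum_eq, ← Module.End.hasEigenvalue_iff_mem_spectrum] at hμ
    obtain ⟨w, hw⟩ := hμ.exists_hasEigenvector
    rcases eq_or_ne μ 0 with rfl | h0
    · simp
    · have h1 := hB _ (charFun_inv_eq_zero_of_eigenvector B h0 hw.2 hw.apply_eq_smul)
      rw [norm_inv] at h1
      have h2 : ‖μ‖ < 1 := by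
        by_contra! h
        exact absurd (inv_le_one_of_one_le₀ h) (not_le.2 h1)
      exact_mod_cast h2
  have hrad : spectralRadius ℂ T < 1 := by
    rcases subsingleton_or_nontrivial ((Fin (q + 1) → Fin n → ℂ) →L[ℂ] (Fin (q + 1) → Fin n → ℂ))
    · simp [spectrum.SpectralRadius.of_subsingleton]
    · exact_mod_cast spectrum.spectralRadius_lt_of_forall_lt T (r := 1) hspec
  obtain ⟨C, ρ, hC, hρ0, hρ1, hdec⟩ := exists_norm_pow_le_of_spectralRadius_lt_one hrad
  -- The rate is split as `σ * σ`: one factor can be spent on the growth of the covariates or on the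
  -- distance to the remote past, the other keeps the series summable.
  refine ⟨C, √ρ, hC, Real.sqrt_pos.2 hρ0, by rw [Real.sqrt_lt' one_pos]; simpa, fun k w => ?_⟩
  rw [Real.mul_self_sqrt hρ0.le]
  let emb : (Fin (q + 1) → Fin n → ℝ) → Fin (q + 1) → Fin n → ℂ := fun w j i => (w j i : ℂ)
  have hnorm : ∀ w, ‖emb w‖ = ‖w‖ := by
    intro w
    simp [emb, Pi.norm_def, Pi.nnnorm_def]
  have hone : ∀ w, companion Bc (emb w) = emb (companion B w) := by
    intro w
    funext j
    refine Fin.cases ?_ (fun j => ?_) j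
    · funext i
      simp [companion_apply_zero, emb, Bc, Matrix.mulVec, dotProduct, Finset.sum_apply]
    · simp only [companion_apply_succ, emb]
  have hcomm : ∀ (k : ℕ) w, (companion Bc ^ k) (emb w) = emb ((companion B ^ k) w) := by
    intro k
    induction k with
    | zero => intro w; simp
    | succ k ih => intro w; rw [pow_succ, pow_succ, Module.End.mul_apply, hone, ih]; rfl
  have hTk : (T ^ k) (emb w) = emb ((companion B ^ k) w) := by
    rw [hT, ← map_pow, ← hcomm]; rfl
  calc ‖(companion B ^ k) w‖ = ‖(T ^ k) (emb w)‖ := by rw [hTk, hnorm]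
    _ ≤ ‖T ^ k‖ * ‖emb w‖ := (T ^ k).le_opNorm _
    _ ≤ C * ρ ^ k * ‖w‖ := by rw [hnorm]; gcongr; exact hdec k

/-- The stationary state `∑ k, companion B ^ k (u_{t-k}, 0, …, 0)` of the linear system with
input `u`. -/
def state (B : Fin q → Matrix (Fin n) (Fin n) ℝ) (u : ℤ → Fin n → ℝ) (t : ℤ) :
    Fin (q + 1) → Fin n → ℝ :=
  ∑' k : ℕ, (companion B ^ k) (Pi.single 0 (u (t - k)))

/-- The series defining the state at time `t` converges. -/
def StateSummable (B : Fin q → Matrix (Fin n) (Fin n) ℝ) (u : ℤ → Fin n → ℝ) (t : ℤ) : Prop :=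
  Summable fun k : ℕ => (companion B ^ k) (Pi.single 0 (u (t - k)))

variable (B : Fin q → Matrix (Fin n) (Fin n) ℝ) {u : ℤ → Fin n → ℝ}

lemma state_eq_add (hu : ∀ t, StateSummable B u t) (t : ℤ) :
    state B u t = Pi.single 0 (u t) + companion B (state B u (t - 1)) := by
  have hterm : ∀ k : ℕ, (companion B ^ (k + 1)) (Pi.single 0 (u (t - (k + 1 : ℕ)))) =
      (LinearMap.toContinuousLinearMap (companion B))
        ((companion B ^ k) (Pi.single 0 (u (t - 1 - k)))) := by
    intro k
    rw [pow_succ', Module.End.mul_apply, show t - ((k + 1 : ℕ) : ℤ) = t - 1 - k by push_cast; ring]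
    rfl
  rw [state, (hu t).tsum_eq_zero_add]
  simp only [hterm]
  rw [← ContinuousLinearMap.map_tsum _ (hu (t - 1))]
  simp [state]

lemma state_apply (hu : ∀ t, StateSummable B u t) (k : ℕ) :
    ∀ (hk : k < q + 1) (t : ℤ), state B u t ⟨k, hk⟩ = state B u (t - k) 0 := by
  induction k with
  | zero => intro hk t; simp
  | succ k ih =>
    intro hk t
    have h1 : state B u t (Fin.succ ⟨k, by omega⟩) = state B u (t - 1) ⟨k, by omega⟩ := by
      rw [state_eq_add B hu, Pi.add_apply, companion_apply_succ]
      simp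
    have h2 : state B u t ⟨k + 1, hk⟩ = state B u (t - 1) ⟨k, by omega⟩ := h1
    rw [h2, ih]
    congr 1
    push_cast
    ring_nf

lemma state_recursion (hu : ∀ t, StateSummable B u t) (t : ℤ) :
    state B u t 0 = ∑ j : Fin q, (B j).mulVec (state B u (t - ((j : ℤ) + 1)) 0) + u t := by
  conv_lhs => rw [state_eq_add B hu, Pi.add_apply, companion_apply_zero, Pi.single_eq_same, add_comm]
  congr 1
  refine Finset.sum_congr rfl fun j _ => ?_
  have := state_apply B hu j (by omega) (t - 1)
  rw [show j.castSucc = ⟨(j : ℕ), by omega⟩ from rfl, this]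
  congr 2
  ring

/-- The input may grow geometrically towards the past. The categories use `τ = 1` and the covariates
`τ = σ⁻¹`. -/
lemma stateSummable_of_bounded {C σ : ℝ} (hC : 0 < C) (hσ0 : 0 < σ)
    (hdec : ∀ (k : ℕ) (w : Fin (q + 1) → Fin n → ℝ),
      ‖(companion B ^ k) w‖ ≤ C * (σ * σ) ^ k * ‖w‖)
    {τ : ℝ} (hτ0 : 0 ≤ τ) (hτ : τ * (σ * σ) < 1) {M : ℝ} {t : ℤ}
    (hu : ∀ᶠ k : ℕ in atTop, ‖u (t - k)‖ ≤ M * τ ^ k) : StateSummable B u t := by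
  have hs : Summable fun k : ℕ => C * M * (τ * (σ * σ)) ^ k :=
    (summable_geometric_of_lt_one (by positivity) hτ).mul_left _
  refine Summable.of_norm_bounded_eventually_nat hs ?_
  filter_upwards [hu] with k hk
  calc _ ≤ C * (σ * σ) ^ k * ‖(Pi.single 0 (u (t - k)) : Fin (q + 1) → Fin n → ℝ)‖ := hdec _ _
    _ = C * (σ * σ) ^ k * ‖u (t - k)‖ := by rw [Pi.norm_single]
    _ ≤ C * (σ * σ) ^ k * (M * τ ^ k) := by gcongr
    _ = _ := by rw [mul_pow]; ring

/-- A solution of the homogeneous recursion is driven by the companion operator. -/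
lemma homogeneous_eq_companion_pow {D : ℤ → Fin n → ℝ}
    (hD : ∀ t, D t = ∑ j : Fin q, (B j).mulVec (D (t - ((j : ℤ) + 1)))) (t : ℤ) (m : ℕ) :
    (fun j : Fin (q + 1) => D (t - (j : ℕ))) =
      (companion B ^ m) (fun j : Fin (q + 1) => D (t - m - (j : ℕ))) := by
  induction m generalizing t with
  | zero => simp
  | succ m ih =>
    have hstep : (fun j : Fin (q + 1) => D (t - (j : ℕ))) =
        companion B (fun j : Fin (q + 1) => D (t - 1 - (j : ℕ))) := by
      funext j
      refine Fin.cases ?_ (fun j => ?_) j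
      · rw [companion_apply_zero]
        simp only [Fin.val_zero, Nat.cast_zero, sub_zero, Fin.val_castSucc]
        rw [hD t]
        refine Finset.sum_congr rfl fun j _ => ?_
        congr 2
        ring
      · rw [companion_apply_succ]
        simp only [Fin.val_succ, Fin.val_castSucc]
        congr 1
        push_cast
        ring
    rw [hstep, ih (t - 1), pow_succ', Module.End.mul_apply]
    congr 3
    funext j
    congr 2
    push_cast
    ring

end Companion

/-! ### The multinomial logistic map. -/

section CatProb

variable {n : ℕ}

/-- The multinomial logistic probabilities of all categories, including the reference one. -/
def catProb (l : Fin n → ℝ) (y : Fin (n + 1)) : ℝ :=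
  Real.exp ((Fin.cons 0 l : Fin (n + 1) → ℝ) y) / (1 + ∑ j, Real.exp (l j))

lemma catProb_succ (l : Fin n → ℝ) (i : Fin n) : catProb l i.succ = logit l i := by
  simp [catProb, logit]

lemma one_add_sum_exp_pos (l : Fin n → ℝ) : 0 < 1 + ∑ j, Real.exp (l j) := by positivity

lemma catProb_pos (l : Fin n → ℝ) (y : Fin (n + 1)) : 0 < catProb l y :=
  div_pos (Real.exp_pos _) (one_add_sum_exp_pos l)

lemma sum_catProb (l : Fin n → ℝ) : ∑ y, catProb l y = 1 := by
  rw [show ∑ y, catProb l y = (∑ y, Real.exp ((Fin.cons 0 l : Fin (n + 1) → ℝ) y)) /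
    (1 + ∑ j, Real.exp (l j)) from (Finset.sum_div _ _ _).symm, Fin.sum_univ_succ]
  simp only [Fin.cons_zero, Real.exp_zero, Fin.cons_succ]
  exact div_self (one_add_sum_exp_pos l).ne'

lemma catProb_zero (l : Fin n → ℝ) : catProb l 0 = 1 - ∑ i, logit l i := by
  have := sum_catProb l
  rw [Fin.sum_univ_succ] at this
  simp only [catProb_succ] at this
  linarith

lemma measurable_catProb (y : Fin (n + 1)) : Measurable fun l : Fin n → ℝ => catProb l y := by
  refine Measurable.div ?_ (by fun_prop)
  refine Real.measurable_exp.comp ?_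
  refine Fin.cases ?_ (fun i => ?_) y
  · simp
  · simp only [Fin.cons_succ]; fun_prop

/-- Numerator and denominator each cost a factor `exp δ`. This turns additive control of the latent
variable into control of ratios of probabilities. -/
lemma catProb_le_exp_mul {l l' : Fin n → ℝ} {δ : ℝ} (hδ : 0 ≤ δ) (h : ∀ i, |l i - l' i| ≤ δ)
    (y : Fin (n + 1)) : catProb l y ≤ Real.exp (2 * δ) * catProb l' y := by
  have h1 : Real.exp ((Fin.cons 0 l : Fin (n + 1) → ℝ) y) ≤
      Real.exp δ * Real.exp ((Fin.cons 0 l' : Fin (n + 1) → ℝ) y) := by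
    rw [← Real.exp_add, Real.exp_le_exp]
    refine Fin.cases ?_ (fun i => ?_) y
    · simpa using hδ
    · have := (abs_le.1 (h i)).2
      simp only [Fin.cons_succ]; linarith
  have h2 : 1 + ∑ j, Real.exp (l' j) ≤ Real.exp δ * (1 + ∑ j, Real.exp (l j)) := by
    rw [mul_add, mul_one, Finset.mul_sum]
    refine add_le_add (Real.one_le_exp hδ) (Finset.sum_le_sum fun j _ => ?_)
    rw [← Real.exp_add, Real.exp_le_exp]
    have := (abs_le.1 (h j)).1
    linarith
  rw [catProb, catProb, two_mul, Real.exp_add, mul_div_assoc',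
    div_le_div_iff₀ (one_add_sum_exp_pos l) (one_add_sum_exp_pos l')]
  calc _ ≤ (Real.exp δ * Real.exp ((Fin.cons 0 l' : Fin (n + 1) → ℝ) y)) *
        (Real.exp δ * (1 + ∑ j, Real.exp (l j))) := by
        gcongr
    _ = _ := by ring

/-- The inverse of the multinomial logistic map. -/
def logitInv (a : Fin n → ℝ) : Fin n → ℝ := fun i => Real.log (a i / (1 - ∑ j, a j))

lemma measurable_logitInv : Measurable (logitInv (n := n)) := by
  unfold logitInv
  refine measurable_pi_lambda _ fun i => Real.measurable_log.comp ?_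
  exact Measurable.div (by fun_prop) (by fun_prop)

/-- The ratio of a category's probability to that of the reference category is `exp (l i)`. The
latent vector can therefore be read off the conditional probabilities. -/
lemma logitInv_logit (l : Fin n → ℝ) : logitInv (logit l) = l := by
  funext i
  have h := one_add_sum_exp_pos l
  rw [logitInv, ← catProb_zero]
  simp only [catProb, logit, Fin.cons_zero, Real.exp_zero]
  rw [div_div_div_cancel_right₀ h.ne', div_one, Real.log_exp]

end CatProb

/-! ### The latent process as a function of the trajectory. -/

section Latent

variable {n d p q : ℕ} (B : Fin q → Matrix (Fin n) (Fin n) ℝ)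
  (A : Fin p → Matrix (Fin n) (Fin n) ℝ) (Γ : Matrix (Fin n) (Fin d) ℝ)

/-- The contribution of the previous categories to the recursion for the latent process. -/
def categoryInput (y : ℤ → Fin (n + 1)) (t : ℤ) : Fin n → ℝ :=
  ∑ l : Fin p, (A l).mulVec (dummy (y (t - ((l : ℤ) + 1))))

/-- The latent process as a function of the trajectory of the categories and the covariates. -/
def latent (t : ℤ) (z : ℤ → Fin (n + 1) × (Fin d → ℝ)) : Fin n → ℝ :=
  state B (categoryInput A fun s => (z s).1) t 0 + state B (fun s => Γ.mulVec (z s).2) t 0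

/-- The conditional probabilities of the multinomial logistic autoregression. -/
def logitKernel (t : ℤ) (y : Fin (n + 1)) (z : ℤ → Fin (n + 1) × (Fin d → ℝ)) : ℝ≥0∞ :=
  ENNReal.ofReal (catProb (latent B A Γ t z) y)

lemma measurable_state_apply {Ω : Type*} [MeasurableSpace Ω] {u : Ω → ℤ → Fin n → ℝ} (t : ℤ)
    (hu : ∀ s, Measurable fun ω => u ω s) : Measurable fun ω => state B (u ω) t 0 := by
  have h : Measurable fun ω => state B (u ω) t := by
    refine Measurable.tsum fun k => ?_
    have h1 : Continuous fun v : Fin n → ℝ =>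
        (companion B ^ k) (Pi.single 0 v : Fin (q + 1) → Fin n → ℝ) :=
      (LinearMap.continuous_of_finiteDimensional _).comp (continuous_single 0)
    exact h1.measurable.comp (hu _)
  exact (measurable_pi_apply 0).comp h

lemma measurable_categoryInput (t : ℤ) : Measurable fun z : ℤ → Fin (n + 1) × (Fin d → ℝ) =>
    categoryInput A (fun s => (z s).1) t := by
  refine Finset.measurable_sum _ fun l _ => ?_
  have h : Measurable fun y : Fin (n + 1) => (A l).mulVec (dummy y) := measurable_of_finite _
  exact h.comp (by fun_prop)

lemma measurable_mulVec (t : ℤ) : Measurable fun z : ℤ → Fin (n + 1) × (Fin d → ℝ) =>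
    Γ.mulVec (z t).2 := by
  have h : Continuous fun x : Fin d → ℝ => Γ.mulVec x := by fun_prop
  exact h.measurable.comp (by fun_prop)

lemma measurable_latent (t : ℤ) : Measurable (latent B A Γ t) :=
  (measurable_state_apply B t (measurable_categoryInput A)).add
    (measurable_state_apply B t (measurable_mulVec Γ))

lemma categoryInput_congr {y y' : ℤ → Fin (n + 1)} {t : ℤ}
    (h : ∀ s ∈ Ico (t - p) t, y s = y' s) : categoryInput A y t = categoryInput A y' t := by
  refine Finset.sum_congr rfl fun l _ => ?_
  rw [h]
  have := l.2
  constructor <;> omega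

/-- Only categories before `t` and covariates up to `t` enter the series. Leaving `J` free covers
both conditionings compared in strict exogeneity. -/
lemma latent_mask {I J : Set ℤ} {t : ℤ} (hI : Iio t ⊆ I) (hJ : Iic t ⊆ J)
    (z : ℤ → Fin (n + 1) × (Fin d → ℝ)) : latent B A Γ t (mask I J z) = latent B A Γ t z := by
  have h1 : ∀ k : ℕ, categoryInput A (fun s => (mask I J z s).1) (t - k) =
      categoryInput A (fun s => (z s).1) (t - k) := fun k => by
    refine categoryInput_congr A fun s hs => ?_
    have : s ∈ I := hI (by have := hs.2; simp only [mem_Iio]; omega)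
    simp [mask, this]
  have h2 : ∀ k : ℕ, (mask I J z (t - k)).2 = (z (t - k)).2 := fun k => by
    have : t - (k : ℤ) ∈ J := hJ (by simp)
    simp [mask, this]
  simp only [latent, state, h1, h2]

lemma latent_shiftBy (m t : ℤ) (z : ℤ → Fin (n + 1) × (Fin d → ℝ)) :
    latent B A Γ t (shiftBy m z) = latent B A Γ (t + m) z := by
  have h : ∀ k : ℕ, t + m - (k : ℤ) = t - k + m := fun k => by ring
  have h' : ∀ (k : ℕ) (l : Fin p), t - (k : ℤ) + m - ((l : ℤ) + 1) = t - k - ((l : ℤ) + 1) + m :=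
    fun k l => by ring
  simp only [latent, state, categoryInput, shiftBy, h, h']

lemma exists_norm_categoryInput_le : ∃ M : ℝ, 0 ≤ M ∧
    ∀ (y : ℤ → Fin (n + 1)) (t : ℤ), ‖categoryInput A y t‖ ≤ M := by
  refine ⟨∑ l : Fin p, ∑ y, ‖(A l).mulVec (dummy y)‖, by positivity, fun y t => ?_⟩
  refine (norm_sum_le _ _).trans (Finset.sum_le_sum fun l _ => ?_)
  exact Finset.single_le_sum (f := fun y => ‖(A l).mulVec (dummy y)‖) (fun _ _ => norm_nonneg _)
    (Finset.mem_univ _)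

lemma stateSummable_categoryInput (hB : ∀ z : ℂ, charFun B z = 0 → 1 < ‖z‖)
    (y : ℤ → Fin (n + 1)) (t : ℤ) : StateSummable B (categoryInput A y) t := by
  obtain ⟨C, σ, hC, hσ0, hσ1, hdec⟩ := exists_norm_companion_pow_le B hB
  obtain ⟨M, -, hM⟩ := exists_norm_categoryInput_le A
  refine stateSummable_of_bounded B hC hσ0 hdec zero_le_one (M := M) ?_ ?_
  · nlinarith
  · exact Eventually.of_forall fun k => by simpa using hM y _

/-- The latent process depends exponentially little on the remote categories. -/
lemma exists_latent_sub_le (hB : ∀ z : ℂ, charFun B z = 0 → 1 < ‖z‖) :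
    ∃ K σ : ℝ, 0 ≤ K ∧ 0 < σ ∧ σ < 1 ∧
      ∀ (t : ℤ) (k : ℕ) (z z' : ℤ → Fin (n + 1) × (Fin d → ℝ)), covariates z = covariates z' →
        (∀ s ∈ Ico (t - k) t, (z s).1 = (z' s).1) →
        ∀ i, |latent B A Γ t z i - latent B A Γ t z' i| ≤ K * σ ^ k := by
  obtain ⟨C, σ, hC, hσ0, hσ1, hdec⟩ := exists_norm_companion_pow_le B hB
  obtain ⟨M, hM0, hM⟩ := exists_norm_categoryInput_le A
  have hσ1' : 0 < 1 - σ := by linarith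
  refine ⟨C * (2 * M) * (σ ^ p)⁻¹ * (1 - σ)⁻¹, σ, by positivity, hσ0, hσ1, ?_⟩
  intro t k z z' hcov hcat i
  set y : ℤ → Fin (n + 1) := fun s => (z s).1
  set y' : ℤ → Fin (n + 1) := fun s => (z' s).1
  have hx : (fun s => Γ.mulVec (z s).2) = fun s => Γ.mulVec (z' s).2 := by
    funext s
    exact congrArg Γ.mulVec (congrFun hcov s)
  -- The covariate parts are identical, even where their series diverges and `tsum` takes its
  -- default value, so the bound holds for every trajectory.
  have hdiff : latent B A Γ t z - latent B A Γ t z' =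
      (state B (categoryInput A y) t - state B (categoryInput A y') t) 0 := by
    simp only [latent, hx, Pi.sub_apply]
    abel
  have hnorm : ‖state B (categoryInput A y) t - state B (categoryInput A y') t‖ ≤
      C * (2 * M) * (σ ^ p)⁻¹ * (1 - σ)⁻¹ * σ ^ k := by
    rw [state, state, ← (stateSummable_categoryInput B A hB y t).tsum_sub
      (stateSummable_categoryInput B A hB y' t)]
    have hsum : HasSum (fun j : ℕ => C * (2 * M) * (σ ^ p)⁻¹ * σ ^ k * σ ^ j)
        (C * (2 * M) * (σ ^ p)⁻¹ * σ ^ k * (1 - σ)⁻¹) :=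
      (hasSum_geometric_of_lt_one hσ0.le hσ1).mul_left _
    rw [show C * (2 * M) * (σ ^ p)⁻¹ * (1 - σ)⁻¹ * σ ^ k =
      C * (2 * M) * (σ ^ p)⁻¹ * σ ^ k * (1 - σ)⁻¹ by ring]
    refine tsum_of_norm_bounded hsum fun j => ?_
    rw [← map_sub, ← Pi.single_sub]
    -- The input at `t - j` reads the categories from `t - j - p` on. If `p + j ≤ k` the two inputs
    -- coincide; otherwise one factor `σ ^ j` is at most `σ ^ k / σ ^ p`, and the other is summed,
    -- giving `(1 - σ)⁻¹`.
    rcases le_or_gt (p + j) k with hj | hj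
    · have : categoryInput A y (t - j) = categoryInput A y' (t - j) := by
        refine categoryInput_congr A fun s hs => hcat s ⟨?_, ?_⟩
        · have := hs.1; omega
        · have := hs.2; omega
      rw [this, sub_self, Pi.single_zero, map_zero, norm_zero]
      positivity
    · have h1 : ‖categoryInput A y (t - j) - categoryInput A y' (t - j)‖ ≤ 2 * M :=
        (norm_sub_le _ _).trans (by linarith [hM y (t - j), hM y' (t - j)])
      have h2 : σ ^ j ≤ (σ ^ p)⁻¹ * σ ^ k := by
        rw [inv_mul_eq_div, le_div_iff₀ (by positivity), ← pow_add, add_comm j p]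
        exact pow_le_pow_of_le_one hσ0.le hσ1.le hj.le
      calc _ ≤ C * (σ * σ) ^ j * ‖(Pi.single 0 (categoryInput A y (t - j) -
              categoryInput A y' (t - j)) : Fin (q + 1) → Fin n → ℝ)‖ := hdec _ _
        _ = C * (σ ^ j * σ ^ j) * ‖categoryInput A y (t - j) - categoryInput A y' (t - j)‖ := by
            rw [Pi.norm_single, mul_pow]
        _ ≤ C * ((σ ^ p)⁻¹ * σ ^ k * σ ^ j) * (2 * M) := by gcongr
        _ = _ := by ring
  calc |latent B A Γ t z i - latent B A Γ t z' i|
      = ‖(state B (categoryInput A y) t - state B (categoryInput A y') t) 0 i‖ := by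
        rw [← hdiff]; rfl
    _ ≤ _ := ((norm_le_pi_norm _ i).trans (norm_le_pi_norm _ 0)).trans hnorm

/-- The conditional probabilities of the multinomial logistic autoregression have bounded
distortion. -/
theorem exists_isSpec_logitKernel (hB : ∀ z : ℂ, charFun B z = 0 → 1 < ‖z‖) :
    ∃ r : ℕ → ℝ, IsSpec (logitKernel B A Γ) r := by
  obtain ⟨K, σ, hK, hσ0, hσ1, h⟩ := exists_latent_sub_le B A Γ hB
  refine ⟨fun k => 2 * (K * σ ^ k), ?_, ?_, ?_, ?_, ?_, ?_⟩
  · exact fun t y => ENNReal.measurable_ofReal.comp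
      ((measurable_catProb y).comp (measurable_latent B A Γ t))
  · intro t y z
    rw [logitKernel, latent_mask B A Γ subset_rfl (subset_univ _), logitKernel]
  · intro t z
    simp only [logitKernel]
    rw [← ENNReal.ofReal_sum_of_nonneg fun y _ => (catProb_pos _ y).le, sum_catProb,
      ENNReal.ofReal_one]
  · intro k; positivity
  · exact ((summable_geometric_of_lt_one hσ0.le hσ1).mul_left K).mul_left 2
  · intro t y k z z' hcov hcat
    rw [logitKernel, logitKernel, ← ENNReal.ofReal_mul (Real.exp_nonneg _)]
    exact ENNReal.ofReal_le_ofReal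
      (catProb_le_exp_mul (by positivity) (h t k z z' hcov hcat) y)

lemma logitKernel_shift (t : ℤ) (y : Fin (n + 1)) (z : ℤ → Fin (n + 1) × (Fin d → ℝ)) :
    logitKernel B A Γ t y (shift z) = logitKernel B A Γ (t + 1) y z := by
  rw [logitKernel, logitKernel, ← latent_shiftBy]
  rfl

/-- The latent process solves its recursion wherever the series of the covariates converges. -/
lemma latent_recursion (hB : ∀ z : ℂ, charFun B z = 0 → 1 < ‖z‖)
    {z : ℤ → Fin (n + 1) × (Fin d → ℝ)}
    (hz : ∀ t, StateSummable B (fun s => Γ.mulVec (z s).2) t) (t : ℤ) :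
    latent B A Γ t z = ∑ j : Fin q, (B j).mulVec (latent B A Γ (t - ((j : ℤ) + 1)) z)
      + ∑ l : Fin p, (A l).mulVec (dummy (z (t - ((l : ℤ) + 1))).1) + Γ.mulVec (z t).2 := by
  conv_lhs => rw [latent, state_recursion B (stateSummable_categoryInput B A hB _),
    state_recursion B hz]
  simp only [latent, Matrix.mulVec_add, Finset.sum_add_distrib, categoryInput]
  abel

lemma measurable_posLog : Measurable Real.posLog := by
  unfold Real.posLog
  exact measurable_const.max Real.measurable_log

/-- The series of a stationary covariate sequence with a logarithmic moment converges almost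
surely. -/
lemma ae_stateSummable (hB : ∀ z : ℂ, charFun B z = 0 → 1 < ‖z‖)
    {μ : Measure (ℤ → Fin d → ℝ)} [IsProbabilityMeasure μ] (hμ : MeasurePreserving shift μ μ)
    (hlog : Integrable (fun x : ℤ → Fin d → ℝ => Real.posLog ‖x 1‖) μ) :
    ∀ᵐ x ∂μ, ∀ t, StateSummable B (fun s => Γ.mulVec (x s)) t := by
  obtain ⟨C, σ, hC, hσ0, hσ1, hdec⟩ := exists_norm_companion_pow_le B hB
  rw [ae_all_iff]
  intro t
  have hlogσ : 0 < -Real.log σ := by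
    have := Real.log_neg hσ0 hσ1
    linarith
  -- Scaled so that `f ≤ k` at the covariate of time `t - k` gives `‖x (t - k)‖ ≤ σ⁻¹ ^ k`.
  -- Integrability of `f` makes the probabilities of `f > k` summable, and stationarity carries them
  -- to time `t - k`.
  set f : (ℤ → Fin d → ℝ) → ℝ := fun x => Real.posLog ‖x 1‖ / (-Real.log σ) with hf
  have hfm : Measurable f := by
    exact (measurable_posLog.comp (by fun_prop)).div_const _
  let inst : MeasureSpace (ℤ → Fin d → ℝ) := ⟨μ⟩
  have hvol : IsProbabilityMeasure (volume : Measure (ℤ → Fin d → ℝ)) := ‹IsProbabilityMeasure μ›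
  have hsum : ∑' j : ℕ, μ {x | f x ∈ Ioi (j : ℝ)} < ∞ :=
    tsum_prob_mem_Ioi_lt_top (hlog.div_const _)
      (fun x => div_nonneg Real.posLog_nonneg hlogσ.le)
  have hsum' : ∑' j : ℕ, μ (shiftBy (t - j - 1) ⁻¹' {x | f x ∈ Ioi (j : ℝ)}) ≠ ∞ := by
    refine ne_of_lt ?_
    convert! hsum using 3 with j
    exact (measurePreserving_shiftBy hμ _).measure_preimage
      (hfm measurableSet_Ioi).nullMeasurableSet
  filter_upwards [ae_eventually_notMem hsum'] with x hx
  obtain ⟨M, hM0, hM⟩ : ∃ M : ℝ, 0 ≤ M ∧ ∀ v : Fin d → ℝ, ‖Γ.mulVec v‖ ≤ M * ‖v‖ :=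
    ⟨‖LinearMap.toContinuousLinearMap Γ.mulVecLin‖, norm_nonneg _,
      fun v => (LinearMap.toContinuousLinearMap Γ.mulVecLin).le_opNorm v⟩
  refine stateSummable_of_bounded B hC hσ0 hdec (M := M) (τ := σ⁻¹) (by positivity) ?_ ?_
  · rw [inv_mul_cancel_left₀ hσ0.ne']; exact hσ1
  · filter_upwards [hx] with k hk
    refine (hM _).trans (mul_le_mul_of_nonneg_left ?_ hM0)
    have h1 : f (shiftBy (t - k - 1) x) ≤ k := by
      by_contra! h
      exact hk h
    have h2 : (shiftBy (t - k - 1) x) 1 = x (t - k) := by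
      rw [shiftBy]; congr 1; ring
    rw [hf] at h1
    simp only [h2] at h1
    rw [div_le_iff₀ hlogσ] at h1
    calc ‖x (t - k)‖ ≤ Real.exp (Real.log ‖x (t - k)‖) := Real.le_exp_log _
      _ ≤ Real.exp (k * -Real.log σ) := by
          rw [Real.exp_le_exp]
          exact (le_max_right _ _).trans h1
      _ = σ⁻¹ ^ k := by rw [Real.exp_nat_mul, Real.exp_neg, Real.exp_log hσ0]

end Latent

/-! ### Conditional probabilities as integral identities, and their transport. -/

section CondProb

variable {Ω : Type*} {m m0 : MeasurableSpace Ω} {P : Measure Ω} [IsProbabilityMeasure P]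

lemma measure_inter_eq_setLIntegral_of_condProb (hm : m ≤ m0) {s : Set Ω} (hs : MeasurableSet s)
    {f : Ω → ℝ} (hf0 : 0 ≤ f) (h : P⟦s | m⟧ =ᵐ[P] f) {A : Set Ω} (hA : MeasurableSet[m] A) :
    P (A ∩ s) = ∫⁻ ω in A, ENNReal.ofReal (f ω) ∂P := by
  have hind : Integrable (s.indicator fun _ => (1 : ℝ)) P := (integrable_const 1).indicator hs
  have hfi : Integrable f P := integrable_condExp.congr h
  have h1 : P.real (A ∩ s) = ∫ ω in A, f ω ∂P := by
    rw [← setIntegral_congr_ae (hm A hA) (h.mono fun ω hω _ => hω), setIntegral_condExp hm hind hA,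
      setIntegral_indicator hs]
    simp
  rw [← ofReal_integral_eq_lintegral_ofReal hfi.integrableOn (ae_of_all _ hf0), ← h1,
    ofReal_measureReal]

lemma condProb_ae_eq (hm : m ≤ m0) {s : Set Ω} (hs : MeasurableSet s) {f : Ω → ℝ}
    (hf : Measurable[m] f) (hf0 : 0 ≤ f) (hf1 : ∀ ω, f ω ≤ 1)
    (h : ∀ A, MeasurableSet[m] A → P (A ∩ s) = ∫⁻ ω in A, ENNReal.ofReal (f ω) ∂P) :
    P⟦s | m⟧ =ᵐ[P] f := by
  have hind : Integrable (s.indicator fun _ => (1 : ℝ)) P := (integrable_const 1).indicator hs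
  have hfi : Integrable f P := by
    refine Integrable.of_bound (hf.mono hm le_rfl).aestronglyMeasurable 1 (ae_of_all _ fun ω => ?_)
    rw [Real.norm_of_nonneg (hf0 ω)]
    exact hf1 ω
  refine (ae_eq_condExp_of_forall_setIntegral_eq hm hind (fun _ _ _ => hfi.integrableOn)
    (fun A hA _ => ?_) hf.stronglyMeasurable.aestronglyMeasurable).symm
  have h1 := h A hA
  rw [← ofReal_integral_eq_lintegral_ofReal hfi.integrableOn (ae_of_all _ hf0)] at h1
  rw [setIntegral_indicator hs]
  have h2 := congrArg ENNReal.toReal h1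
  rw [ENNReal.toReal_ofReal (integral_nonneg hf0)] at h2
  simp [← h2, Measure.real]

/-- Applied to the trajectory seen from time `t`, it expresses the conditional probabilities at all
times through a single function on the path space. -/
lemma condProb_comap {Ω' : Type*} {m' m0' : MeasurableSpace Ω'} (hm : m' ≤ m0') {Q : Measure Ω'}
    {f : Ω → Ω'} (hf : MeasurePreserving f P Q) {s : Set Ω'} (hs : MeasurableSet s) :
    P⟦f ⁻¹' s | m'.comap f⟧ =ᵐ[P] fun ω => (Q⟦s | m'⟧) (f ω) := by
  have hQ : IsProbabilityMeasure Q := by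
    rw [← hf.map_eq]; exact Measure.isProbabilityMeasure_map hf.measurable.aemeasurable
  have hm' : m'.comap f ≤ m0 := (MeasurableSpace.comap_mono hm).trans hf.measurable.comap_le
  have hη : StronglyMeasurable[m'] (Q⟦s | m'⟧) := stronglyMeasurable_condExp
  have hind : Integrable ((f ⁻¹' s).indicator fun _ => (1 : ℝ)) P :=
    (integrable_const 1).indicator (hf.measurable hs)
  have hηi : Integrable (fun ω => (Q⟦s | m'⟧) (f ω)) P :=
    hf.integrable_comp_of_integrable integrable_condExp
  refine (ae_eq_condExp_of_forall_setIntegral_eq hm' hind (fun _ _ _ => hηi.integrableOn)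
    ?_ ?_).symm
  · rintro _ ⟨A, hA, rfl⟩ -
    have hA' := hm A hA
    have h1 : ∫ ω in f ⁻¹' A, (Q⟦s | m'⟧) (f ω) ∂P = ∫ ω in A, (Q⟦s | m'⟧) ω ∂Q := by
      rw [← hf.map_eq, setIntegral_map hA' _ hf.measurable.aemeasurable, hf.map_eq]
      rw [hf.map_eq]
      exact (hη.mono hm).aestronglyMeasurable
    rw [h1, setIntegral_condExp hm ((integrable_const 1).indicator hs) hA,
      setIntegral_indicator hs, setIntegral_indicator (hf.measurable hs), ← preimage_inter]
    simp only [setIntegral_const, smul_eq_mul, mul_one, Measure.real]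
    rw [hf.measure_preimage (hA'.inter hs).nullMeasurableSet]
  · exact (hη.comp_measurable (comap_measurable f)).aestronglyMeasurable

end CondProb

/-! ### Stationary solutions and Gibbs laws. -/

section Solution

variable {n d p q : ℕ} {B : Fin q → Matrix (Fin n) (Fin n) ℝ}
  {A : Fin p → Matrix (Fin n) (Fin n) ℝ} {Γ : Matrix (Fin n) (Fin d) ℝ}
  {Ω : Type*} [MeasurableSpace Ω] {P : Measure Ω}
  {X : ℤ → Ω → Fin d → ℝ} {Y : ℤ → Ω → Fin (n + 1)} {lam : ℤ → Ω → Fin n → ℝ}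

lemma measurable_path {S : Type*} [MeasurableSpace S] {Z : ℤ → Ω → S} (hZ : ∀ t, Measurable (Z t)) :
    Measurable (path Z) := measurable_pi_lambda _ hZ

lemma comap_path_window {E S : Type*} [MeasurableSpace E] [MeasurableSpace S] [Inhabited E]
    [Inhabited S] (Y : ℤ → Ω → E) (X : ℤ → Ω → S) (I J : Set ℤ) :
    (window I J).comap (path fun t ω => (Y t ω, X t ω)) = sigmaGen Y I ⊔ sigmaGen X J := by
  simp only [window_eq_sigmaGen, sigmaGen, MeasurableSpace.comap_sup, MeasurableSpace.comap_iSup,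
    MeasurableSpace.comap_comp]
  rfl

lemma comap_shiftBy_window {E S : Type*} [MeasurableSpace E] [MeasurableSpace S] [Inhabited E]
    [Inhabited S] (t : ℤ) :
    (window (E := E) (S := S) (Iio 0) (Iic 0)).comap (shiftBy t) = window (Iio t) (Iic t) := by
  have h1 : mask (Iio 0) (Iic 0) ∘ shiftBy t =
      shiftBy t ∘ mask (E := E) (S := S) (Iio t) (Iic t) := by
    funext z s
    simp [mask, shiftBy]
  have h2 : (MeasurableSpace.pi : MeasurableSpace (ℤ → E × S)).comap (shiftBy t) =
      MeasurableSpace.pi := by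
    refine le_antisymm (measurable_shiftBy t).comap_le ?_
    have h3 : (id : (ℤ → E × S) → ℤ → E × S) = shiftBy (-t) ∘ shiftBy t := by
      funext z
      simp [shiftBy_shiftBy, shiftBy_zero]
    have h4 := MeasurableSpace.comap_mono (g := shiftBy t)
      (measurable_shiftBy (S := E × S) (-t)).comap_le
    rwa [MeasurableSpace.comap_comp, ← h3, MeasurableSpace.comap_id] at h4
  simp only [window, MeasurableSpace.comap_comp]
  rw [h1, ← MeasurableSpace.comap_comp, h2]

/-- The Gibbs property needs to be checked for the non-reference categories only. -/
lemma isGibbs_of_succ {S : Type*} [MeasurableSpace S] [Inhabited S]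
    {g : ℤ → Fin (n + 1) → (ℤ → Fin (n + 1) × S) → ℝ≥0∞} {r : ℕ → ℝ} (hg : IsSpec g r)
    {Q : Measure (ℤ → Fin (n + 1) × S)} [IsFiniteMeasure Q]
    (h : ∀ (t : ℤ) (i : Fin n) (C : Set (ℤ → Fin (n + 1) × S)),
      MeasurableSet[window (Iio t) univ] C →
      Q (C ∩ {z | (z t).1 = i.succ}) = ∫⁻ z in C, g t i.succ z ∂Q) : IsGibbs g Q := by
  intro t y C hC
  have hC' := window_le _ _ _ hC
  have h1 : ∑ y, Q (C ∩ {z | (z t).1 = y}) = Q C := by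
    rw [← measure_biUnion_finset]
    · congr 1
      ext z
      simp
    · intro y _ y' _ hne
      refine disjoint_left.2 fun z hz hz' => hne ?_
      exact hz.2.symm.trans hz'.2
    · exact fun y _ => hC'.inter (measurableSet_category t y)
  have h2 : ∑ y, ∫⁻ z in C, g t y z ∂Q = Q C := by
    rw [← lintegral_finsetSum _ fun y _ => hg.measurable t y]
    simp [hg.sum_eq_one]
  refine Fin.cases ?_ (fun i => h t i C hC) y
  rw [← h2, Fin.sum_univ_succ, Fin.sum_univ_succ] at h1
  simp only [h t _ C hC] at h1
  refine (ENNReal.add_left_inj ?_).1 h1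
  exact ENNReal.sum_ne_top.2 fun i _ => hg.setLIntegral_ne_top Q t i.succ C

lemma IsSolution.measurable_path (hsol : IsSolution B A Γ P X Y lam) :
    Measurable (path fun t ω => (Y t ω, X t ω)) :=
  MultinomialLogit.measurable_path fun t => (hsol.measurable_Y t).prodMk (hsol.measurable_X t)

lemma measurePreserving_shiftBy_path {S : Type*} [MeasurableSpace S] {Z : ℤ → Ω → S}
    (hZ : Measurable (path Z)) (h : IsStationary P Z) (t : ℤ) :
    MeasurePreserving (fun ω => shiftBy t (path Z ω)) P (P.map (path Z)) :=
  (measurePreserving_shiftBy h t).comp ⟨hZ, rfl⟩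

/-- The latent process of a stationary solution is a fixed function of the shifted trajectory. -/
lemma IsSolution.exists_lam_eq [IsProbabilityMeasure P] (hsol : IsSolution B A Γ P X Y lam)
    (hst : IsStationary P fun t ω => (Y t ω, X t ω)) :
    ∃ Λ : (ℤ → Fin (n + 1) × (Fin d → ℝ)) → Fin n → ℝ, Measurable Λ ∧
      ∀ t, ∀ᵐ ω ∂P, lam t ω = Λ (shiftBy t (path (fun t ω => (Y t ω, X t ω)) ω)) := by
  set Φ := path fun t ω => (Y t ω, X t ω) with hΦ
  have hΦm : Measurable Φ := hsol.measurable_path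
  let η : Fin n → (ℤ → Fin (n + 1) × (Fin d → ℝ)) → ℝ := fun i =>
    (P.map Φ)⟦{z | (z 0).1 = i.succ} | window (Iio 0) (Iic 0)⟧
  have hη : ∀ i, Measurable (η i) := fun i =>
    (stronglyMeasurable_condExp.mono (window_le (Iio 0) (Iic 0))).measurable
  refine ⟨fun z => logitInv fun i => η i z,
    measurable_logitInv.comp (measurable_pi_lambda _ hη), fun t => ?_⟩
  have hpres := measurePreserving_shiftBy_path hΦm hst t
  have hcomap : (window (Iio 0) (Iic 0)).comap (fun ω => shiftBy t (Φ ω)) =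
      sigmaGen Y (Iio t) ⊔ sigmaGen X (Iic t) := by
    rw [← comap_path_window, ← comap_shiftBy_window t]
    exact (MeasurableSpace.comap_comp (f := shiftBy t) (g := Φ)).symm
  have hcond : ∀ i : Fin n, (fun ω => η i (shiftBy t (Φ ω))) =ᵐ[P] fun ω => logit (lam t ω) i := by
    intro i
    have h1 := condProb_comap (window_le (Iio 0) (Iic 0)) hpres
      (measurableSet_category (S := Fin d → ℝ) 0 i.succ)
    have h2 : (fun ω => shiftBy t (Φ ω)) ⁻¹' {z | (z 0).1 = i.succ} = Y t ⁻¹' {i.succ} := by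
      ext ω
      simp [shiftBy, hΦ, path]
    rw [hcomap, h2] at h1
    exact h1.symm.trans (hsol.condProb t i)
  filter_upwards [ae_all_iff.2 hcond] with ω hω
  rw [← logitInv_logit (lam t ω)]
  congr 1
  funext i
  exact (hω i).symm

lemma ae_stateSummable_path [IsProbabilityMeasure P] (hB : ∀ z : ℂ, charFun B z = 0 → 1 < ‖z‖)
    (hX : ∀ t, Measurable (X t)) (hst : IsStationary P X)
    (hlog : Integrable (fun ω => Real.posLog ‖X 1 ω‖) P) :
    ∀ᵐ ω ∂P, ∀ t, StateSummable B (fun s => Γ.mulVec (X s ω)) t := by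
  have hm := measurable_path hX
  have hp := Measure.isProbabilityMeasure_map (μ := P) hm.aemeasurable
  refine ae_of_ae_map hm.aemeasurable (ae_stateSummable B Γ hB hst ?_)
  rw [integrable_map_measure _ hm.aemeasurable]
  · exact hlog
  · have : Measurable fun x : ℤ → Fin d → ℝ => Real.posLog ‖x 1‖ := measurable_posLog.comp (by fun_prop)
    exact this.aestronglyMeasurable

/-- The latent process of a stationary solution is the stationary solution of the recursion. -/
theorem IsSolution.lam_eq_latent [IsProbabilityMeasure P]
    (hB : ∀ z : ℂ, charFun B z = 0 → 1 < ‖z‖) (hsol : IsSolution B A Γ P X Y lam)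
    (hst : IsStationary P fun t ω => (Y t ω, X t ω)) (hstX : IsStationary P X)
    (hlog : Integrable (fun ω => Real.posLog ‖X 1 ω‖) P) :
    ∀ᵐ ω ∂P, ∀ t, lam t ω = latent B A Γ t (path (fun t ω => (Y t ω, X t ω)) ω) := by
  obtain ⟨Λ, hΛm, hΛ⟩ := hsol.exists_lam_eq hst
  obtain ⟨C, σ, hC, hσ0, hσ1, hdec⟩ := exists_norm_companion_pow_le B hB
  set Φ := path fun t ω => (Y t ω, X t ω) with hΦ
  have hΦm : Measurable Φ := hsol.measurable_path
  set δ : (ℤ → Fin (n + 1) × (Fin d → ℝ)) → Fin n → ℝ := fun z => Λ z - latent B A Γ 0 z with hδ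
  have hδm : Measurable δ := hΛm.sub (measurable_latent B A Γ 0)
  set D : ℤ → Ω → Fin n → ℝ := fun t ω => δ (shiftBy t (Φ ω)) with hD
  have hlamD : ∀ᵐ ω ∂P, ∀ t, lam t ω = D t ω + latent B A Γ t (Φ ω) := by
    rw [ae_all_iff]
    intro t
    filter_upwards [hΛ t] with ω hω
    rw [hω, hD, hδ]
    simp only [latent_shiftBy, zero_add, sub_add_cancel]
  have hhom : ∀ᵐ ω ∂P, ∀ t, D t ω = ∑ j : Fin q, (B j).mulVec (D (t - ((j : ℤ) + 1)) ω) := by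
    filter_upwards [hlamD, ae_all_iff.2 hsol.recursion, ae_stateSummable_path (Γ := Γ) hB
      hsol.measurable_X hstX hlog] with ω h1 h2 h3 t
    have h4 := latent_recursion B A Γ hB (z := Φ ω) h3 t
    have h5 := h2 t
    simp only [h1, Matrix.mulVec_add, Finset.sum_add_distrib] at h5
    rw [h4] at h5
    have h6 : D t ω + (∑ j : Fin q, (B j).mulVec (latent B A Γ (t - ((j : ℤ) + 1)) (Φ ω))
        + ∑ l : Fin p, (A l).mulVec (dummy (Φ ω (t - ((l : ℤ) + 1))).1) + Γ.mulVec (Φ ω t).2) =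
      ∑ j : Fin q, (B j).mulVec (D (t - ((j : ℤ) + 1)) ω) +
        (∑ j : Fin q, (B j).mulVec (latent B A Γ (t - ((j : ℤ) + 1)) (Φ ω))
        + ∑ l : Fin p, (A l).mulVec (dummy (Φ ω (t - ((l : ℤ) + 1))).1) + Γ.mulVec (Φ ω t).2) := by
      rw [h5]
      simp only [hΦ, path]
      abel
    exact add_right_cancel h6
  -- The tail of `D t` does not depend on `t`. This replaces any moment assumption on the latent
  -- process.
  have hlaw : ∀ (t : ℤ) (a : ℝ), P {ω | a < ‖D t ω‖} = P.map Φ {z | a < ‖δ z‖} := fun t a =>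
    (measurePreserving_shiftBy_path hΦm hst t).measure_preimage
      (measurableSet_lt measurable_const hδm.norm).nullMeasurableSet
  have hp := Measure.isProbabilityMeasure_map (μ := P) hΦm.aemeasurable
  have htail : Tendsto (fun a : ℝ => P.map Φ {z | a < ‖δ z‖}) atTop (𝓝 0) := by
    have h := tendsto_measure_iInter_atTop (μ := P.map Φ) (s := fun a : ℝ => {z | a < ‖δ z‖})
      (fun a => (measurableSet_lt measurable_const hδm.norm).nullMeasurableSet)
      (fun a b hab z hz => lt_of_le_of_lt hab hz) ⟨0, measure_ne_top _ _⟩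
    have hempty : ⋂ a : ℝ, {z | a < ‖δ z‖} = ∅ := by
      ext z
      simp only [mem_iInter, mem_ofPred_eq, mem_empty_iff_false, iff_false, not_forall, not_lt]
      exact ⟨‖δ z‖, le_rfl⟩
    rw [hempty, measure_empty] at h
    exact h
  -- By contraction over `m` steps, `‖D t‖ > ε` forces one of the `q + 1` values of `D` around time
  -- `t - m` to exceed `ε / C * (σ * σ)⁻¹ ^ m`. A union bound and the common tail conclude as `m`
  -- grows.
  have hbound : ∀ (t : ℤ) (ε : ℝ), 0 < ε → ∀ m : ℕ, P {ω | ε < ‖D t ω‖} ≤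
      (q + 1 : ℕ) * P.map Φ {z | ε / C * ((σ * σ)⁻¹) ^ m < ‖δ z‖} := by
    intro t ε hε m
    have h1 : P {ω | ε < ‖D t ω‖} ≤
        P (⋃ j : Fin (q + 1), {ω | ε / C * ((σ * σ)⁻¹) ^ m < ‖D (t - m - (j : ℕ)) ω‖}) := by
      refine measure_mono_ae ?_
      filter_upwards [hhom] with ω hω hε'
      by_contra hcon
      have h2 := homogeneous_eq_companion_pow B (D := fun t => D t ω) hω t m
      have hcon' : ∀ j : Fin (q + 1), ‖D (t - m - (j : ℕ)) ω‖ ≤ ε / C * ((σ * σ)⁻¹) ^ m :=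
        fun j => not_lt.1 fun hj => hcon (mem_iUnion.2 ⟨j, hj⟩)
      have h3 : ‖D t ω‖ ≤ ε := by
        calc ‖D t ω‖ ≤ ‖fun j : Fin (q + 1) => D (t - (j : ℕ)) ω‖ := by
              have := norm_le_pi_norm (fun j : Fin (q + 1) => D (t - (j : ℕ)) ω) 0
              simpa using this
          _ ≤ C * (σ * σ) ^ m * ‖fun j : Fin (q + 1) => D (t - m - (j : ℕ)) ω‖ := by
              rw [h2]; exact hdec _ _
          _ ≤ C * (σ * σ) ^ m * (ε / C * ((σ * σ)⁻¹) ^ m) := by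
              gcongr
              exact (pi_norm_le_iff_of_nonneg (by positivity)).2 hcon'
          _ = ε := by
              rw [inv_pow]
              field_simp
      exact absurd h3 (not_le.2 hε')
    refine h1.trans ((measure_iUnion_le _).trans ?_)
    simp only [hlaw]
    simp
  have hzero : ∀ᵐ ω ∂P, ∀ t, D t ω = 0 := by
    rw [ae_all_iff]
    intro t
    have h1 : ∀ ε : ℝ, 0 < ε → P {ω | ε < ‖D t ω‖} = 0 := by
      intro ε hε
      have hgrow : Tendsto (fun m : ℕ => ε / C * ((σ * σ)⁻¹) ^ m) atTop atTop := by
        refine Tendsto.const_mul_atTop (by positivity) (tendsto_pow_atTop_atTop_of_one_lt ?_)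
        exact (one_lt_inv₀ (by positivity)).2 (by nlinarith)
      have h2 := ENNReal.Tendsto.const_mul (a := ((q + 1 : ℕ) : ℝ≥0∞)) (htail.comp hgrow)
        (Or.inr (ENNReal.natCast_ne_top _))
      rw [mul_zero] at h2
      exact le_antisymm (ge_of_tendsto' h2 fun m => hbound t ε hε m) zero_le
    have h2 : ∀ᵐ ω ∂P, ∀ k : ℕ, ‖D t ω‖ ≤ 1 / ((k : ℝ) + 1) := by
      rw [ae_all_iff]
      intro k
      rw [ae_iff]
      simp only [not_le]
      exact h1 _ (by positivity)
    filter_upwards [h2] with ω hω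
    have h3 : ‖D t ω‖ ≤ 0 := ge_of_tendsto' tendsto_one_div_add_atTop_nhds_zero_nat hω
    exact norm_le_zero_iff.1 h3
  filter_upwards [hlamD, hzero] with ω h1 h2 t
  rw [h1, h2, zero_add]

/-- The law of the trajectory of a solution whose latent process is `latent` is Gibbs. -/
theorem IsSolution.isGibbs [IsProbabilityMeasure P] {r : ℕ → ℝ}
    (hr : IsSpec (logitKernel B A Γ) r) (hsol : IsSolution B A Γ P X Y lam)
    (hlat : ∀ᵐ ω ∂P, ∀ t, lam t ω = latent B A Γ t (path (fun t ω => (Y t ω, X t ω)) ω)) :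
    IsGibbs (logitKernel B A Γ) (P.map (path fun t ω => (Y t ω, X t ω))) := by
  set Φ := path fun t ω => (Y t ω, X t ω) with hΦ
  have hΦm : Measurable Φ := hsol.measurable_path
  have hp := Measure.isProbabilityMeasure_map (μ := P) hΦm.aemeasurable
  refine isGibbs_of_succ hr fun t i C hC => ?_
  have hC' := window_le _ _ _ hC
  have hcond : P⟦Y t ⁻¹' {i.succ} | (window (Iio t) univ).comap Φ⟧ =ᵐ[P]
      fun ω => catProb (latent B A Γ t (Φ ω)) i.succ := by
    rw [hΦ, comap_path_window]
    -- Strict exogeneity replaces the covariates up to `t` by the whole covariate path, as the Gibbs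
    -- property requires.
    refine (hsol.exogenous t i.succ).symm.trans ((hsol.condProb t i).trans ?_)
    filter_upwards [hlat] with ω hω
    rw [catProb_succ, ← hω t]
  have h := measure_inter_eq_setLIntegral_of_condProb
    ((MeasurableSpace.comap_mono (window_le _ _)).trans hΦm.comap_le)
    (hsol.measurable_Y t (measurableSet_singleton _)) (fun ω => (catProb_pos _ _).le) hcond
    (A := Φ ⁻¹' C) ⟨C, hC, rfl⟩
  rw [Measure.map_apply hΦm (hC'.inter (measurableSet_category t _)),
    setLIntegral_map hC' (hr.measurable t _) hΦm]
  exact h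

/-- A process whose trajectory has a Gibbs law is a solution. -/
theorem isSolution_of_isGibbs [IsProbabilityMeasure P]
    (hB : ∀ z : ℂ, charFun B z = 0 → 1 < ‖z‖) (hX : ∀ t, Measurable (X t))
    (hY : ∀ t, Measurable (Y t)) (hstX : IsStationary P X)
    (hlog : Integrable (fun ω => Real.posLog ‖X 1 ω‖) P)
    (hG : IsGibbs (logitKernel B A Γ) (P.map (path fun t ω => (Y t ω, X t ω)))) :
    IsSolution B A Γ P X Y
      (fun t ω => latent B A Γ t (path (fun t ω => (Y t ω, X t ω)) ω)) := by
  set Φ := path fun t ω => (Y t ω, X t ω) with hΦ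
  have hΦm : Measurable Φ := measurable_path fun t => (hY t).prodMk (hX t)
  -- The kernel is already measurable for the smaller conditioning. `J = Iic t` gives the logistic
  -- probabilities, and comparison with `J = univ` gives exogeneity.
  have hcond : ∀ (t : ℤ) (y : Fin (n + 1)) (J : Set ℤ), Iic t ⊆ J →
      P⟦Y t ⁻¹' {y} | sigmaGen Y (Iio t) ⊔ sigmaGen X J⟧ =ᵐ[P]
        fun ω => catProb (latent B A Γ t (Φ ω)) y := by
    intro t y J hJ
    rw [← comap_path_window]
    refine condProb_ae_eq ((MeasurableSpace.comap_mono (window_le _ _)).trans hΦm.comap_le)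
      (hY t (measurableSet_singleton _)) ?_ (fun ω => (catProb_pos _ _).le) ?_ ?_
    · have h1 : Measurable[window (Iio t) J] fun z : ℤ → Fin (n + 1) × (Fin d → ℝ) =>
          catProb (latent B A Γ t z) y :=
        measurable_window_of_mask ((measurable_catProb y).comp (measurable_latent B A Γ t))
          fun z => by rw [latent_mask B A Γ subset_rfl hJ]
      exact h1.comp (comap_measurable _)
    · intro ω
      rw [← sum_catProb (latent B A Γ t (Φ ω))]
      exact Finset.single_le_sum (f := fun y => catProb (latent B A Γ t (Φ ω)) y)
        (fun y _ => (catProb_pos _ y).le) (Finset.mem_univ y)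
    · rintro _ ⟨C, hC, rfl⟩
      have hC' := window_le _ _ _ hC
      have h1 := hG t y C (window_mono subset_rfl (subset_univ _) _ hC)
      rw [Measure.map_apply hΦm (hC'.inter (measurableSet_category t _)),
        setLIntegral_map hC' _ hΦm] at h1
      · exact h1
      · exact ENNReal.measurable_ofReal.comp
          ((measurable_catProb y).comp (measurable_latent B A Γ t))
  refine ⟨hX, hY, fun t => (measurable_latent B A Γ t).comp hΦm, fun t => ?_, fun t i => ?_,
    fun t y => ?_⟩
  · filter_upwards [ae_stateSummable_path (Γ := Γ) hB hX hstX hlog] with ω hω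
    exact latent_recursion B A Γ hB (z := Φ ω) hω t
  · refine (hcond t i.succ _ subset_rfl).trans (ae_of_all _ fun ω => ?_)
    exact catProb_succ _ _
  · exact (hcond t y _ subset_rfl).trans (hcond t y _ (subset_univ _)).symm

end Solution

/-! ### Realising a joint law on an enlarged space. -/

section Lift

variable {Ω 𝒳 𝒴 : Type*} [MeasurableSpace Ω] [MeasurableSpace 𝒳] [MeasurableSpace 𝒴]

/-- A joint law whose first marginal is the law of a random variable `ξ` is realised on an
enlargement of the space on which `ξ` is defined. -/
lemma exists_measure_prod_map_eq [StandardBorelSpace 𝒴] [Nonempty 𝒴] (P : Measure Ω)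
    [IsProbabilityMeasure P] {ξ : Ω → 𝒳} (hξ : Measurable ξ) (ρ : Measure (𝒳 × 𝒴))
    [IsFiniteMeasure ρ] (hρ : ρ.fst = P.map ξ) :
    ∃ P' : Measure (Ω × 𝒴), IsProbabilityMeasure P' ∧ P'.map Prod.fst = P ∧
      P'.map (Prod.map ξ id) = ρ := by
  -- Given `ω`, the second coordinate is drawn from the conditional law under `ρ` at the point `ξ
  -- ω`.
  refine ⟨P.compProd (ρ.condKernel.comap ξ hξ), inferInstance, Measure.fst_compProd P _, ?_⟩
  conv_rhs => rw [← ρ.disintegrate ρ.condKernel, hρ]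
  refine Measure.ext fun s hs => ?_
  have hm : Measurable (Prod.map ξ (id : 𝒴 → 𝒴)) := hξ.prodMap measurable_id
  rw [Measure.map_apply hm hs, Measure.compProd_apply (hm hs), Measure.compProd_apply hs,
    lintegral_map (Kernel.measurable_kernel_prodMk_left hs) hξ]
  rfl

end Lift

/-! ### Adjoining the latent process to the trajectory. -/

section Triple

variable {n d p q : ℕ} (B : Fin q → Matrix (Fin n) (Fin n) ℝ)
  (A : Fin p → Matrix (Fin n) (Fin n) ℝ) (Γ : Matrix (Fin n) (Fin d) ℝ)

/-- The trajectory of categories, covariates and latent variables, as a function of the trajectory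
of categories and covariates. -/
def withLatent (z : ℤ → Fin (n + 1) × (Fin d → ℝ)) :
    ℤ → Fin (n + 1) × (Fin d → ℝ) × (Fin n → ℝ) :=
  fun t => ((z t).1, (z t).2, latent B A Γ t z)

lemma measurable_withLatent : Measurable (withLatent B A Γ) := by
  refine measurable_pi_lambda _ fun t => ?_
  exact Measurable.prodMk (by fun_prop) (Measurable.prodMk (by fun_prop) (measurable_latent B A Γ t))

lemma shift_withLatent (z : ℤ → Fin (n + 1) × (Fin d → ℝ)) :
    shift (withLatent B A Γ z) = withLatent B A Γ (shift z) := by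
  funext t
  simp only [shift, withLatent]
  rw [← latent_shiftBy]
  rfl

lemma measurePreserving_shift_map {S S' : Type*} [MeasurableSpace S] [MeasurableSpace S']
    {Q : Measure (ℤ → S)} (hQ : MeasurePreserving shift Q Q) {f : (ℤ → S) → ℤ → S'}
    (hf : Measurable f) (h : ∀ z, shift (f z) = f (shift z)) :
    MeasurePreserving shift (Q.map f) (Q.map f) := by
  refine ⟨measurable_shiftBy 1, ?_⟩
  have hs : Measurable (shift : (ℤ → S') → ℤ → S') := measurable_shiftBy 1
  conv_rhs => rw [← hQ.map_eq]
  rw [Measure.map_map hs hf, Measure.map_map hf hQ.measurable]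
  congr 1
  funext z
  exact h z

end Triple

end MultinomialLogit

/-! ### The main theorem. -/

open MultinomialLogit

theorem proposition4 {n d p q : ℕ} (hn : 1 ≤ n)
    (B : Fin q → Matrix (Fin n) (Fin n) ℝ) (A : Fin p → Matrix (Fin n) (Fin n) ℝ)
    (Γ : Matrix (Fin n) (Fin d) ℝ)
    {Ω : Type*} [MeasurableSpace Ω] (P : Measure Ω) [IsProbabilityMeasure P]
    (X : ℤ → Ω → Fin d → ℝ) (hX : ∀ t, Measurable (X t))
    (hXerg : MultinomialLogit.IsStationaryErgodic P X)
    (hXlog : Integrable (fun ω => Real.posLog ‖X 1 ω‖) P)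
    (hB : ∀ z : ℂ, MultinomialLogit.charFun B z = 0 → 1 < ‖z‖) :
    -- Existence, on the enlargement `Ω × {0, …, n}^ℤ` of the space on which `X` is defined.
    ∃ (P' : Measure (Ω × (ℤ → Fin (n + 1))))
      (X' : ℤ → Ω × (ℤ → Fin (n + 1)) → Fin d → ℝ)
      (Y' : ℤ → Ω × (ℤ → Fin (n + 1)) → Fin (n + 1))
      (lam' : ℤ → Ω × (ℤ → Fin (n + 1)) → Fin n → ℝ),
      P'.map Prod.fst = P ∧ (∀ t ω, X' t ω = X t ω.1) ∧ (∀ t ω, Y' t ω = ω.2 t) ∧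
      MultinomialLogit.IsSolution B A Γ P' X' Y' lam' ∧
      MultinomialLogit.IsStationary P' (fun t ω => (Y' t ω, X' t ω, lam' t ω)) ∧
      MultinomialLogit.IsStationaryErgodic P' (fun t ω => (Y' t ω, X' t ω)) ∧
      -- Uniqueness in law among the stationary solutions, on any probability space, driven by a
      -- covariate process with the law of `X`.
      (∀ {Ω'' : Type*} [MeasurableSpace Ω''] (P'' : Measure Ω'') [IsProbabilityMeasure P'']
        (X'' : ℤ → Ω'' → Fin d → ℝ) (Y'' : ℤ → Ω'' → Fin (n + 1)) (lam'' : ℤ → Ω'' → Fin n → ℝ),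
        P''.map (MultinomialLogit.path X'') = P.map (MultinomialLogit.path X) →
        MultinomialLogit.IsSolution B A Γ P'' X'' Y'' lam'' →
        MultinomialLogit.IsStationary P'' (fun t ω => (Y'' t ω, X'' t ω)) →
        P''.map (MultinomialLogit.path (fun t ω => (Y'' t ω, X'' t ω, lam'' t ω))) =
          P'.map (MultinomialLogit.path (fun t ω => (Y' t ω, X' t ω, lam' t ω)))) := by
  obtain ⟨r, hr⟩ := exists_isSpec_logitKernel B A Γ hB
  have hXm : Measurable (path X) := measurable_path hX
  have hμ : IsProbabilityMeasure (P.map (path X)) :=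
    Measure.isProbabilityMeasure_map hXm.aemeasurable
  obtain ⟨Q, hQp, hQμ, hQ⟩ := exists_isGibbs hr (P.map (path X))
  have hsplit : Measurable fun z : ℤ → Fin (n + 1) × (Fin d → ℝ) =>
      (covariates z, fun s => (z s).1) := measurable_covariates.prodMk (by fun_prop)
  obtain ⟨P', hP'p, hP'fst, hP'map⟩ := exists_measure_prod_map_eq P hXm
    (Q.map fun z => (covariates z, fun s => (z s).1))
    (by rw [Measure.fst, Measure.map_map measurable_fst hsplit, ← hQμ]; rfl)
  set X' : ℤ → Ω × (ℤ → Fin (n + 1)) → Fin d → ℝ := fun t ω => X t ω.1 with hX'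
  set Y' : ℤ → Ω × (ℤ → Fin (n + 1)) → Fin (n + 1) := fun t ω => ω.2 t with hY'
  have hX'm : ∀ t, Measurable (X' t) := fun t => (hX t).comp measurable_fst
  have hY'm : ∀ t, Measurable (Y' t) := fun t => (measurable_pi_apply t).comp measurable_snd
  have hfst : MeasurePreserving (Prod.fst : Ω × (ℤ → Fin (n + 1)) → Ω) P' P :=
    ⟨measurable_fst, hP'fst⟩
  have hΦm : Measurable (path fun t ω => (Y' t ω, X' t ω)) :=
    measurable_path fun t => (hY'm t).prodMk (hX'm t)
  have hlaw : P'.map (path fun t ω => (Y' t ω, X' t ω)) = Q := by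
    have hJ : Measurable fun p : (ℤ → Fin d → ℝ) × (ℤ → Fin (n + 1)) => pairing p.2 p.1 := by
      unfold pairing; fun_prop
    have h1 := congrArg
      (fun R => R.map fun p : (ℤ → Fin d → ℝ) × (ℤ → Fin (n + 1)) => pairing p.2 p.1) hP'map
    rw [Measure.map_map hJ (hXm.prodMap measurable_id), Measure.map_map hJ hsplit] at h1
    exact h1.trans Measure.map_id
  have hstX : MultinomialLogit.IsStationary P X := hXerg.toMeasurePreserving
  have hlawX : P'.map (path X') = P.map (path X) := by
    rw [← hP'fst, Measure.map_map hXm measurable_fst]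
    rfl
  have hstX' : MultinomialLogit.IsStationary P' X' := by
    rw [MultinomialLogit.IsStationary, hlawX]; exact hstX
  have hsol := isSolution_of_isGibbs (A := A) (Γ := Γ) hB hX'm hY'm hstX'
    (hfst.integrable_comp_of_integrable hXlog) (by rw [hlaw]; exact hQ)
  have hlawW : P'.map (path fun t ω => (Y' t ω, X' t ω,
      latent B A Γ t (path (fun t ω => (Y' t ω, X' t ω)) ω))) = Q.map (withLatent B A Γ) := by
    rw [← hlaw, Measure.map_map (measurable_withLatent B A Γ) hΦm]
    rfl
  have hQst : MeasurePreserving shift Q Q :=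
    hQ.measurePreserving_shift hr (logitKernel_shift B A Γ) (by rw [hQμ]; exact hstX)
  refine ⟨P', X', Y', _, hP'fst, fun _ _ => rfl, fun _ _ => rfl, hsol, ?_, ?_, ?_⟩
  · rw [MultinomialLogit.IsStationary, hlawW]
    exact measurePreserving_shift_map hQst (measurable_withLatent B A Γ)
      (shift_withLatent B A Γ)
  · rw [IsStationaryErgodic, hlaw]
    exact hQ.ergodic hr (logitKernel_shift B A Γ) (by rw [hQμ]; exact hXerg)
  · intro Ω'' _ P'' _ X'' Y'' lam'' hX'' hsol'' hst''
    have hX''m : Measurable (path X'') := measurable_path hsol''.measurable_X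
    have hstX'' : MultinomialLogit.IsStationary P'' X'' := by
      rw [MultinomialLogit.IsStationary, hX'']; exact hstX
    have hlog : Integrable (fun ω => Real.posLog ‖X'' 1 ω‖) P'' := by
      have hm : AEStronglyMeasurable (fun x : ℤ → Fin d → ℝ => Real.posLog ‖x 1‖)
          (P.map (path X)) :=
        (measurable_posLog.comp (measurable_pi_apply 1).norm).aestronglyMeasurable
      have h1 : Integrable (fun x : ℤ → Fin d → ℝ => Real.posLog ‖x 1‖) (P.map (path X)) :=
        (integrable_map_measure hm hXm.aemeasurable).2 hXlog
      rw [← hX''] at h1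
      exact h1.comp_measurable hX''m
    have hlat := hsol''.lam_eq_latent hB hst'' hstX'' hlog
    have hΦ'' := hsol''.measurable_path
    have hp := Measure.isProbabilityMeasure_map (μ := P'') hΦ''.aemeasurable
    have hQ'' : P''.map (path fun t ω => (Y'' t ω, X'' t ω)) = Q := by
      refine IsGibbs.eq_of_map_covariates_eq hr (hsol''.isGibbs hr hlat) hQ ?_
      rw [hQμ, ← hX'', Measure.map_map measurable_covariates hΦ'']
      rfl
    -- Both triples are the image under `withLatent` of a pair trajectory of law `Q`, exactly for
    -- the constructed solution and almost surely for the other.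
    rw [hlawW, ← hQ'', Measure.map_map (measurable_withLatent B A Γ) hΦ'']
    refine Measure.map_congr ?_
    filter_upwards [hlat] with ω hω
    funext t
    simp only [path, withLatent, Function.comp, hω t]

end
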